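/- **Setting.** Let $0<\alpha<1$, $T>0$, let $\Omega\subset\mathbb R^d$ be a bounded open set (for instance a convex polyhedral domain, $d=1,2,3$), and let $\kappa:\Omega\to\mathbb R$ be measurable with $0<\kappa_{\min}\le\kappa\le\kappa_{\max}<\infty$ a.e. on $\Omega$. Write $\langle\cdot,\cdot\rangle$ and $\|\cdot\|$ for the inner product and norm of $L^2(\Omega)$ (scalar or vector valued), $V=H^1_0(\Omega)$ for the closure of $C_c^\infty(\Omega)$ in $H^1(\Omega)$, and put $$\mathcal A w=-\nabla\cdot(\kappa\nabla w),\qquad \mathcal I^{\beta}f(t)=\int_0^t\frac{(t-s)^{\beta-1}}{\Gamma(\beta)}f(s)\,ds\quad(\beta>0),\qquad \mathcal I=\mathcal I^1 .$$ Let $\theta\in L^2(0,T;L^2(\Omega)^d)$ and let $w$ be the weak solution of $$\partial_t^\alpha w+\mathcal A w=-\nabla\cdot\theta\quad\text{on }\Omega\times(0,T],\qquad w=0\ \text{on }\partial\Omega\times(0,T],\qquad w(\cdot,0)=0\ \text{in }\Omega ,$$ that is, $w\in L^2(0,T;V)$ and, for every $v\in V$, $$\partial_t^\alpha\langle w(t),v\rangle+\langle\kappa\nabla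 w(t),\nabla v\rangle=\langle\theta(t),\nabla v\rangle .$$ Here, for $\varphi,g\in L^1(0,T)$, the equation $\partial_t^\alpha\varphi=g$ with zero initial value is understood in the generalized Caputo sense $\frac{d}{dt}\mathcal I^{1-\alpha}\varphi=g$ with $\mathcal I^{1-\alpha}\varphi$ vanishing at $t=0$, i.e. $\mathcal I^{1-\alpha}\varphi(t)=\int_0^tg(s)\,ds$ for a.e. $t\in(0,T)$. If $\varphi$ is absolutely continuous on $[0,T]$ with $\varphi(0)=0$, this says that $g$ is the usual Caputo derivative $\mathcal I^{1-\alpha}\varphi'$. **Lemma.** There is a constant $C>0$ that depends only on $\alpha$ such that, in this setting, the following hold. 1. For every $t\in(0,T]$, $$\mathcal I\big(\|\sqrt\kappa\,\nabla w\|^2\big)(t)\le\mathcal I\big(\|\theta/\sqrt\kappa\|^2\big)(t).$$ 2. Suppose in addition that $\Theta(t)=t\,\theta(t)$ has a weak time derivative $\Theta'\in L^2(0,T;L^2(\Omega)^d)$. Then, after modification on a null set of times, $w$ is continuous from $(0,T]$ to $V$; the function $\mathcal W(t)=t\,w(t)$ is absolutely continuous with values in $V$ and differentiable a.e., with $\mathcal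 W'\in L^2(0,T;V)$ and $\mathcal W(t)=\int_0^t\mathcal W'(s)\,ds$; and for every $t\in(0,T]$, $$\mathcal I\big(\|\sqrt\kappa\,\nabla\mathcal W'\|^2\big)(t)\le2\,\mathcal I\big(\|\theta/\sqrt\kappa\|^2+\|\Theta'/\sqrt\kappa\|^2\big)(t),$$ $$\|\sqrt\kappa\,\nabla w(t)\|^2\le2\,t^{-1}\,\mathcal I\big(\|\theta/\sqrt\kappa\|^2+\|\Theta'/\sqrt\kappa\|^2\big)(t),$$ $$\|w(t)\|^2\le C\,t^{\alpha-1}\,\mathcal I\big(\|\theta/\sqrt\kappa\|^2+\|\Theta'/\sqrt\kappa\|^2\big)(t).$$ -/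

import Mathlib

open MeasureTheory Set
open scoped ContDiff Convolution

/-! ### Fractional integrals and the Caputo derivative -/

/-- The Riemann--Liouville fractional integral of order `β > 0`:
`(I^β f)(t) = ∫₀ᵗ ω_β(t - s) f(s) ds` with `ω_β(t) = t^(β - 1) / Γ(β)`. -/
noncomputable def rlIntegral (β : ℝ) (f : ℝ → ℝ) (t : ℝ) : ℝ :=
  ∫ s in (0 : ℝ)..t, (t - s) ^ (β - 1) / Real.Gamma β * f s

/-- `HasCaputoDeriv₀ α T φ g`: the scalar function `φ`, with zero initial value, has the Caputo
derivative `g` of order `α` on `(0, T]`, in the usual generalized sense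
`g = d/dt I^(1-α) (φ - φ₀)` with initial value `φ₀ = 0`, where `I^(1-α) φ` vanishes at `t = 0`;
that is, `I^(1-α) φ (t) = ∫₀ᵗ g(s) ds` for almost every `t`.
The lemma `hasCaputoDeriv₀_of_primitive` below shows that this holds with `g = I^(1-α) φ'`
whenever `φ` is absolutely continuous with `φ 0 = 0`. -/
structure HasCaputoDeriv₀ (α T : ℝ) (φ g : ℝ → ℝ) : Prop where
  integrable : IntegrableOn φ (Ioc 0 T)
  integrable_deriv : IntegrableOn g (Ioc 0 T)
  rlIntegral_eq : ∀ᵐ t ∂volume.restrict (Ioc 0 T),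
    rlIntegral (1 - α) φ t = ∫ s in (0 : ℝ)..t, g s

/-! ### `L²(Ω)`, `H¹₀(Ω)` and the solution concept -/

/-- `L²(Ω; F)` for `Ω ⊆ ℝᵈ`. -/
abbrev L2 {d : ℕ} (Ω : Set (EuclideanSpace ℝ (Fin d))) (F : Type) [NormedAddCommGroup F] : Type :=
  Lp F 2 ((volume : Measure (EuclideanSpace ℝ (Fin d))).restrict Ω)

/-- The Hilbert space `L²(Ω) × L²(Ω)ᵈ`, with norm `(‖p₁‖² + ‖p₂‖²)^(1/2)`. -/
abbrev L2Pair {d : ℕ} (Ω : Set (EuclideanSpace ℝ (Fin d))) : Type :=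
  WithLp 2 (L2 Ω ℝ × L2 Ω (EuclideanSpace ℝ (Fin d)))

/-- The pairs `(φ, ∇φ)` with `φ ∈ C_c^∞(Ω)`, as a subspace of `L²(Ω) × L²(Ω)ᵈ`. -/
noncomputable def testGraph {d : ℕ} (Ω : Set (EuclideanSpace ℝ (Fin d))) : Submodule ℝ (L2Pair Ω) where
  carrier := {p | ∃ φ : EuclideanSpace ℝ (Fin d) → ℝ,
    ContDiff ℝ ∞ φ ∧ HasCompactSupport φ ∧ tsupport φ ⊆ Ω ∧
    (p.fst : EuclideanSpace ℝ (Fin d) → ℝ) =ᵐ[volume.restrict Ω] φ ∧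
    (p.snd : EuclideanSpace ℝ (Fin d) → EuclideanSpace ℝ (Fin d))
      =ᵐ[volume.restrict Ω] fun x => gradient φ x}
  zero_mem' := by
    refine ⟨0, contDiff_const, HasCompactSupport.zero, by simp [tsupport], ?_, ?_⟩
    · exact Lp.coeFn_zero _ _ _
    · refine (Lp.coeFn_zero _ _ _).trans (Filter.Eventually.of_forall fun x => ?_)
      simp [gradient]
  add_mem' := by
    rintro p q ⟨φ, hφ, hφc, hφs, hp1, hp2⟩ ⟨ψ, hψ, hψc, hψs, hq1, hq2⟩
    refine ⟨φ + ψ, hφ.add hψ, hφc.add hψc,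
      (tsupport_add φ ψ).trans (union_subset hφs hψs), ?_, ?_⟩
    · filter_upwards [Lp.coeFn_add p.fst q.fst, hp1, hq1] with x h h1 h2
      simp only [WithLp.add_fst, h, Pi.add_apply, h1, h2]
    · filter_upwards [Lp.coeFn_add p.snd q.snd, hp2, hq2] with x h h1 h2
      simp only [WithLp.add_snd, h, Pi.add_apply, h1, h2, gradient]
      rw [fderiv_add (hφ.differentiable (by simp) x) (hψ.differentiable (by simp) x), map_add]
  smul_mem' := by
    rintro c p ⟨φ, hφ, hφc, hφs, hp1, hp2⟩
    refine ⟨c • φ, contDiff_const.smul hφ, hφc.smul_left (f := fun _ => c),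
      (closure_mono (Function.support_const_smul_subset c φ)).trans hφs, ?_, ?_⟩
    · filter_upwards [Lp.coeFn_smul c p.fst, hp1] with x h h1
      simp only [WithLp.smul_fst, h, Pi.smul_apply, h1]
    · filter_upwards [Lp.coeFn_smul c p.snd, hp2] with x h h1
      simp only [WithLp.smul_snd, h, Pi.smul_apply, h1, gradient]
      rw [fderiv_const_smul (hφ.differentiable (by simp) x), map_smul]

/-- `V = H¹₀(Ω)`, the closure of `C_c^∞(Ω)` in the `H¹` norm. An element `v` is represented by
the pair of the function `v` and its weak gradient; the inherited norm is the `H¹` norm. -/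
noncomputable def H10 {d : ℕ} (Ω : Set (EuclideanSpace ℝ (Fin d))) : Submodule ℝ (L2Pair Ω) :=
  (testGraph Ω).topologicalClosure

instance {d : ℕ} (Ω : Set (EuclideanSpace ℝ (Fin d))) : CompleteSpace (H10 Ω) :=
  (testGraph Ω).isClosed_topologicalClosure.completeSpace_coe

/-- The `L²(Ω)` function underlying an element of `H¹₀(Ω)`. -/
noncomputable def h10Val {d : ℕ} {Ω : Set (EuclideanSpace ℝ (Fin d))} (v : H10 Ω) : L2 Ω ℝ :=
  (v : L2Pair Ω).fst

/-- The weak gradient of an element of `H¹₀(Ω)`. -/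
noncomputable def h10Grad {d : ℕ} {Ω : Set (EuclideanSpace ℝ (Fin d))} (v : H10 Ω) :
    L2 Ω (EuclideanSpace ℝ (Fin d)) :=
  (v : L2Pair Ω).snd

/-- The squared weighted norm `‖ρ q‖² = ∫_Ω |ρ(x) q(x)|² dx` of a vector field `q`. -/
noncomputable def weightedNormSq {d : ℕ} (Ω : Set (EuclideanSpace ℝ (Fin d)))
    (ρ : EuclideanSpace ℝ (Fin d) → ℝ) (q : L2 Ω (EuclideanSpace ℝ (Fin d))) : ℝ :=
  ∫ x in Ω, ‖ρ x • q x‖ ^ 2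

/-- Weak solutions of `∂_t^α w + 𝒜 w = -∇·θ` on `Ω × (0, T]`, `𝒜 w = -∇·(κ ∇w)`, with
homogeneous Dirichlet boundary condition and zero initial condition: `w ∈ L²(0, T; H¹₀(Ω))` and,
for every `v ∈ H¹₀(Ω)`, `⟨∂_t^α w, v⟩ + ⟨κ ∇w, ∇v⟩ = ⟨θ, ∇v⟩`. -/
structure IsWeakSolution (α T : ℝ) {d : ℕ} (Ω : Set (EuclideanSpace ℝ (Fin d)))
    (κ : EuclideanSpace ℝ (Fin d) → ℝ) (θ : ℝ → L2 Ω (EuclideanSpace ℝ (Fin d)))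
    (w : ℝ → H10 Ω) : Prop where
  memLp : MemLp w 2 (volume.restrict (Ioc 0 T))
  hasCaputoDeriv : ∀ v : H10 Ω, HasCaputoDeriv₀ α T
    (fun t => inner ℝ (h10Val (w t)) (h10Val v))
    (fun t => inner ℝ (θ t) (h10Grad v) - ∫ x in Ω, κ x * inner ℝ (h10Grad (w t) x) (h10Grad v x))

/-- `u` has the weak time derivative `u' ∈ L²(0, T; F)`: up to a null set, `u` is absolutely
continuous on `[0, T]`, being a constant plus the primitive of `u'`. -/
structure HasL2TimeDeriv {F : Type*} [NormedAddCommGroup F] [NormedSpace ℝ F]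
    (T : ℝ) (u u' : ℝ → F) : Prop where
  memLp : MemLp u' 2 (volume.restrict (Ioc 0 T))
  exists_const : ∃ c : F, ∀ᵐ t ∂volume.restrict (Ioc 0 T), u t = c + ∫ s in (0 : ℝ)..t, u' s

/-! ### Consistency with the classical Caputo derivative `I^(1-α) φ'` -/

/-- If `φ` is absolutely continuous on `[0, T]` with `φ 0 = 0`, then its derivative in the
generalized sense is the classical Caputo derivative `I^(1-α) φ'`. -/
theorem hasCaputoDeriv₀_of_primitive {α T : ℝ} (hα : α < 1) {φ φ' : ℝ → ℝ}
    (hφ' : IntegrableOn φ' (Ioc 0 T)) (hφ : ∀ t ∈ Ioc 0 T, φ t = ∫ s in (0 : ℝ)..t, φ' s) :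
    HasCaputoDeriv₀ α T φ (rlIntegral (1 - α) φ') := by
  set L := ContinuousLinearMap.mul ℝ ℝ with hL
  set k : ℝ → ℝ := (Ioc 0 T).indicator fun s => s ^ (1 - α - 1) / Real.Gamma (1 - α) with hk
  set f : ℝ → ℝ := (Ioc 0 T).indicator φ' with hf
  set H : ℝ → ℝ := (Ico 0 T).indicator fun _ => 1 with hH
  have ik : Integrable k := by
    rw [hk, integrable_indicator_iff measurableSet_Ioc]
    by_cases hT : 0 ≤ T
    · have := (intervalIntegral.intervalIntegrable_rpow' (a := 0) (b := T)
        (r := 1 - α - 1) (by linarith)).div_const (Real.Gamma (1 - α))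
      rwa [intervalIntegrable_iff_integrableOn_Ioc_of_le hT] at this
    · rw [Ioc_eq_empty (by simpa using le_of_not_ge hT)]
      exact integrableOn_empty
  have jf : Integrable f := by
    rwa [hf, integrable_indicator_iff measurableSet_Ioc]
  have iH : Integrable H := by
    rw [hH, integrable_indicator_iff measurableSet_Ico]
    exact integrableOn_const (by simp)
  -- convolutions of functions supported in `[0, T]`
  have e1 : ∀ g : ℝ → ℝ, ∀ t ∈ Ioc 0 T,
      ((Ioc 0 T).indicator g ⋆[L] k) t = rlIntegral (1 - α) g t := by
    intro g t ht
    rw [convolution_def, rlIntegral, intervalIntegral.integral_of_le ht.1.le,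
      integral_Ioc_eq_integral_Ioo, ← integral_indicator measurableSet_Ioo]
    congr 1
    ext s
    by_cases h1 : s ∈ Ioo 0 t
    · have h2 : s ∈ Ioc 0 T := ⟨h1.1, h1.2.le.trans ht.2⟩
      have h3 : t - s ∈ Ioc 0 T := ⟨sub_pos.2 h1.2, by linarith [h1.1, ht.2]⟩
      simp [hL, hk, h1, h2, h3, mul_comm]
    · by_cases h2 : s ∈ Ioc 0 T
      · have h3 : t - s ∉ Ioc 0 T := fun h => h1 ⟨h2.1, sub_pos.1 h.1⟩
        simp only [hL, hk, h1, h3, indicator_of_notMem, not_false_eq_true, map_zero]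
      · simp [hL, h1, h2]
  have e2 : ∀ g G : ℝ → ℝ, (∀ s ∈ Ioc 0 T, g s = G s) → (∀ s, s ≤ 0 → g s = 0) →
      ∀ t ∈ Ioc 0 T, (g ⋆[L] H) t = ∫ s in (0 : ℝ)..t, G s := by
    intro g G hg hg0 t ht
    rw [convolution_def, intervalIntegral.integral_of_le ht.1.le,
      ← integral_indicator measurableSet_Ioc]
    congr 1
    ext s
    by_cases h1 : s ∈ Ioc 0 t
    · have h2 : s ∈ Ioc 0 T := ⟨h1.1, h1.2.trans ht.2⟩
      have h3 : t - s ∈ Ico 0 T := ⟨sub_nonneg.2 h1.2, by linarith [h1.1, ht.2]⟩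
      simp [hL, hH, h1, h3, hg s h2]
    · by_cases h2 : s ≤ 0
      · simp [hL, h1, hg0 s h2]
      · have h3 : t - s ∉ Ico 0 T := fun h => h1 ⟨not_le.1 h2, sub_nonneg.1 h.1⟩
        simp only [hL, hH, h1, h3, indicator_of_notMem, not_false_eq_true, map_zero]
  have z1 : ∀ g k : ℝ → ℝ, (∀ s, s ≤ 0 → g s = 0) → (∀ s, s < 0 → k s = 0) →
      ∀ t, t ≤ 0 → (g ⋆[L] k) t = 0 := by
    intro g k hg hk t ht
    rw [convolution_def]
    refine (integral_congr_ae (Filter.Eventually.of_forall fun s => ?_)).trans (integral_zero ℝ ℝ)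
    by_cases h : s ≤ 0
    · simp [hL, hg s h]
    · simp [hL, hk (t - s) (by linarith [not_le.1 h])]
  have hf0 : ∀ s, s ≤ 0 → f s = 0 := fun s hs =>
    indicator_of_notMem (fun h => not_lt.2 hs h.1) _
  have hk0 : ∀ s, s < 0 → k s = 0 := fun s hs =>
    indicator_of_notMem (fun h => not_lt.2 hs.le h.1) _
  have hfk : Integrable (f ⋆[L] k) := jf.integrable_convolution L ik
  have hfH : Integrable (f ⋆[L] H) := jf.integrable_convolution L iH
  refine ⟨?_, ?_, ?_⟩
  · refine hfH.integrableOn.congr_fun (fun t ht => ?_) measurableSet_Ioc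
    rw [hφ t ht]
    exact e2 f φ' (fun s hs => indicator_of_mem hs _) hf0 t ht
  · exact hfk.integrableOn.congr_fun (fun t ht => e1 φ' t ht) measurableSet_Ioc
  · have hHk : Integrable ((fun x => ‖H x‖) ⋆[ContinuousLinearMap.mul ℝ ℝ] fun x => ‖k x‖) :=
      iH.norm.integrable_convolution _ ik.norm
    have hkH : Integrable ((fun x => ‖k x‖) ⋆[ContinuousLinearMap.mul ℝ ℝ] fun x => ‖H x‖) :=
      ik.norm.integrable_convolution _ iH.norm
    have a1 := jf.norm.ae_convolution_exists (ContinuousLinearMap.mul ℝ ℝ) hHk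
    have a2 := jf.norm.ae_convolution_exists (ContinuousLinearMap.mul ℝ ℝ) hkH
    filter_upwards [ae_restrict_of_ae a1, ae_restrict_of_ae a2,
      ae_restrict_mem measurableSet_Ioc] with t h1 h2 ht
    have A1 : ((f ⋆[L] H) ⋆[L] k) t = (f ⋆[L] (H ⋆[L] k)) t :=
      convolution_assoc L L L L (fun x y z => by simp [hL, mul_assoc])
        jf.aestronglyMeasurable iH.aestronglyMeasurable ik.aestronglyMeasurable
        (jf.ae_convolution_exists L iH)
        (iH.norm.ae_convolution_exists (ContinuousLinearMap.mul ℝ ℝ) ik.norm) h1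
    have A2 : ((f ⋆[L] k) ⋆[L] H) t = (f ⋆[L] (k ⋆[L] H)) t :=
      convolution_assoc L L L L (fun x y z => by simp [hL, mul_assoc])
        jf.aestronglyMeasurable ik.aestronglyMeasurable iH.aestronglyMeasurable
        (jf.ae_convolution_exists L ik)
        (ik.norm.ae_convolution_exists (ContinuousLinearMap.mul ℝ ℝ) iH.norm) h2
    have A3 : H ⋆[L] k = k ⋆[L] H := by
      have := convolution_flip (f := k) (g := H) (μ := (volume : Measure ℝ)) L
      rw [← this]
      congr 1
      ext
      simp [hL]
    have B1 : ((f ⋆[L] H) ⋆[L] k) t = rlIntegral (1 - α) φ t := by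
      have : f ⋆[L] H =ᵐ[volume.restrict (Ioc 0 t)] φ := by
        filter_upwards [ae_restrict_mem measurableSet_Ioc] with s hs
        have hs' : s ∈ Ioc 0 T := ⟨hs.1, hs.2.trans ht.2⟩
        rw [hφ s hs']
        exact e2 f φ' (fun s hs => indicator_of_mem hs _) hf0 s hs'
      rw [← e1 φ t ht, convolution_def, convolution_def]
      congr 1
      ext s
      by_cases hs : s ≤ 0
      · rw [z1 f H hf0 (fun s hs => indicator_of_notMem (fun h => not_le.2 hs h.1) _) s hs,
          indicator_of_notMem (fun h => not_lt.2 hs h.1)]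
      · by_cases hs' : s ∈ Ioc 0 T
        · rw [indicator_of_mem hs', hφ s hs',
            e2 f φ' (fun s hs => indicator_of_mem hs _) hf0 s hs']
        · have : k (t - s) = 0 := hk0 _ (by
            have : T < s := not_le.1 fun h => hs' ⟨not_le.1 hs, h⟩
            linarith [ht.2])
          simp [hL, this]
    have B2 : ((f ⋆[L] k) ⋆[L] H) t = ∫ s in (0 : ℝ)..t, rlIntegral (1 - α) φ' s :=
      e2 (f ⋆[L] k) _ (fun s hs => e1 φ' s hs) (z1 f k hf0 hk0) t ht
    rw [← B1, ← B2, A1, A2, A3]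

/-! ### Young's inequality in time. -/

section Young
open ENNReal

variable {E : Type*} [NormedAddCommGroup E] [NormedSpace ℝ E]

/-! Let `J` be the embedding of `V` into `L²(Ω)`, `G = √κ ∇` and `η = θ/√κ`. Write `I^α` for the
fractional integral and `k = rlKernel (1 - α)`. Applying `I^α` to the weak form turns it into an
identity in `L²(0, T; V)`, namely `J†J w = I^α G†(η - G w)` (`solvesVolterra_of_hasCaputoDeriv`).
From then on only this abstract equation matters, and no regularity of `w` in time is presupposed.

All estimates come from the energy inequality `k(t) ∫₀ᵗ ‖J w‖² ≤ ∫₀ᵗ ⟨η - G w, G w⟩`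
(`SolvesVolterra.energy`). It rests on the coercivity `⟨h, I^α h⟩ ≥ k(T) ‖I^α h‖²`
(`inner_volterraL_rlKernel_ge`), which follows from the positivity and monotonicity of `k`. For
trial functions `w = I^α h` the energy inequality is this coercivity applied to `J h`. The
right-hand sides that belong to trial functions are dense, and an a priori bound allows passage to
the limit, so some solution satisfies the inequality for every source
(`IsVolterraSolution.exists_and_energy`). Uniqueness makes it the given solution. Expanding `‖η‖² =
‖(η - G w) + G w‖²` then bounds both `G w` and `η - G w` by `η` in `L²(0, t)`, which contains the
first claim.

For the second claim, let `z = η - G w`. The commutator `t I^α f = I^α(t f) + α I^α ∫₀ᵗ f` shows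
that `t w` solves the equation with source `t η + α ∫₀ᵗ z`, which is the primitive of `σ = (t η)' +
α z`. If `f` solves the equation with source `σ`, then `∫₀ᵗ f` solves it with the primitive of `σ`,
so `t w = ∫₀ᵗ f` by uniqueness. Thus `f` is the derivative of `t w`, with no difference quotients.
The energy bounds for `f` and Cauchy–Schwarz for the mean `w(t) = t⁻¹ ∫₀ᵗ f` give the three
estimates (`SolvesVolterra.regularity`). -/

theorem sq_lintegral_mul_le {X : Type*} [MeasurableSpace X] {μ : Measure X} {a f : X → ℝ≥0∞}
    (ha : AEMeasurable a μ) (hf : AEMeasurable f μ) :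
    (∫⁻ x, a x * f x ∂μ) ^ 2 ≤ (∫⁻ x, a x ∂μ) * ∫⁻ x, a x * f x ^ 2 ∂μ := by
  -- Cauchy–Schwarz for the splitting `a f = a^(1/2) · (a^(1/2) f)`.
  have h := ENNReal.lintegral_mul_le_Lp_mul_Lq μ Real.HolderConjugate.two_two
    (ha.pow_const (1 / 2 : ℝ)) ((ha.pow_const (1 / 2 : ℝ)).mul hf)
  have e1 : ∀ x, ((fun x => a x ^ (1 / 2 : ℝ)) * ((fun x => a x ^ (1 / 2 : ℝ)) * f)) x
      = a x * f x := by
    intro x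
    simp only [Pi.mul_apply]
    rw [← mul_assoc, ← ENNReal.rpow_add_of_nonneg _ _ (by norm_num) (by norm_num)]
    norm_num
  have e2 : ∀ x, (a x ^ (1 / 2 : ℝ)) ^ (2 : ℝ) = a x := by
    intro x
    rw [← ENNReal.rpow_mul]; norm_num
  have e3 : ∀ x, ((fun x => a x ^ (1 / 2 : ℝ)) * f) x ^ (2 : ℝ) = a x * f x ^ 2 := by
    intro x
    simp only [Pi.mul_apply]
    rw [ENNReal.mul_rpow_of_nonneg _ _ (by norm_num), e2]
    norm_num
  simp only [e1, e2, e3] at h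
  calc _ ≤ _ := pow_le_pow_left' h 2
    _ = _ := by
      rw [mul_pow, ← ENNReal.rpow_natCast, ← ENNReal.rpow_natCast, ← ENNReal.rpow_mul,
        ← ENNReal.rpow_mul]
      norm_num

theorem eLpNorm_two_sq {X G : Type*} [MeasurableSpace X] [NormedAddCommGroup G] {μ : Measure X}
    (f : X → G) :
    eLpNorm f 2 μ ^ 2 = ∫⁻ x, ‖f x‖ₑ ^ 2 ∂μ := by
  rw [eLpNorm_eq_lintegral_rpow_enorm_toReal (by norm_num) (by norm_num), ← ENNReal.rpow_natCast,
    ← ENNReal.rpow_mul]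
  norm_num

/-- Young's inequality `‖a * f‖₂ ≤ ‖a‖₁ ‖f‖₂`. -/
theorem eLpNorm_convolution_le {a : ℝ → ℝ} {f : ℝ → E} (ha : AEStronglyMeasurable a)
    (hf : AEStronglyMeasurable f) :
    eLpNorm (a ⋆[ContinuousLinearMap.lsmul ℝ ℝ] f) 2 volume
      ≤ (∫⁻ x, ‖a x‖ₑ) * eLpNorm f 2 volume := by
  have hp : eLpNorm (a ⋆[ContinuousLinearMap.lsmul ℝ ℝ] f) 2 volume ^ 2
      ≤ ((∫⁻ x, ‖a x‖ₑ) * eLpNorm f 2 volume) ^ 2 := by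
    rw [mul_pow, eLpNorm_two_sq, eLpNorm_two_sq]
    have hm : AEMeasurable (Function.uncurry fun t s : ℝ => ‖a s‖ₑ * ‖f (t - s)‖ₑ ^ 2)
        (volume.prod volume) := by
      refine ha.enorm.comp_snd.mul (AEMeasurable.pow_const ?_ 2)
      exact (hf.comp_quasiMeasurePreserving
        (quasiMeasurePreserving_sub (volume : Measure ℝ) volume)).enorm
    calc ∫⁻ t, ‖(a ⋆[ContinuousLinearMap.lsmul ℝ ℝ] f) t‖ₑ ^ 2
        ≤ ∫⁻ t, (∫⁻ s, ‖a s‖ₑ) * ∫⁻ s, ‖a s‖ₑ * ‖f (t - s)‖ₑ ^ 2 := by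
          refine lintegral_mono fun t => ?_
          refine le_trans (pow_le_pow_left' ?_ 2) (sq_lintegral_mul_le ha.enorm
            (hf.comp_quasiMeasurePreserving
              (quasiMeasurePreserving_sub_left_of_right_invariant volume t)).enorm)
          refine (enorm_integral_le_lintegral_enorm _).trans (lintegral_mono fun s => ?_)
          simp [enorm_smul]
      _ = (∫⁻ s, ‖a s‖ₑ) * ∫⁻ t, ∫⁻ s, ‖a s‖ₑ * ‖f (t - s)‖ₑ ^ 2 := by
          rw [lintegral_const_mul'']
          exact hm.lintegral_prod_right'
      _ = (∫⁻ s, ‖a s‖ₑ) * ∫⁻ s, ∫⁻ t, ‖a s‖ₑ * ‖f (t - s)‖ₑ ^ 2 := by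
          rw [lintegral_lintegral_swap hm]
      _ = (∫⁻ s, ‖a s‖ₑ) * ∫⁻ s, ‖a s‖ₑ * ∫⁻ t, ‖f t‖ₑ ^ 2 := by
          congr 2
          ext s
          have hs : AEMeasurable (fun t => ‖f (t - s)‖ₑ ^ 2) :=
            (hf.comp_quasiMeasurePreserving
              (measurePreserving_sub_right volume s).quasiMeasurePreserving).enorm.pow_const 2
          rw [lintegral_const_mul'' _ hs,
            lintegral_sub_right_eq_self (fun t => ‖f t‖ₑ ^ 2) s]
      _ = _ := by
          rw [lintegral_mul_const'' _ ha.enorm, sq, mul_assoc]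
  exact le_of_not_gt fun h => absurd hp (not_le.2 (by gcongr))

end Young

/-! ### Algebra of Volterra convolutions. -/

section Volterra

variable {E F : Type*} [NormedAddCommGroup E] [NormedSpace ℝ E]
  [NormedAddCommGroup F] [NormedSpace ℝ F]

/-- The Volterra convolution `∫₀ᵗ a(t - s) f(s) ds`. -/
noncomputable def volterra (a : ℝ → ℝ) (f : ℝ → E) (t : ℝ) : E :=
  ∫ s in (0 : ℝ)..t, a (t - s) • f s

theorem volterra_congr {a b : ℝ → ℝ} {f g : ℝ → E} {T t : ℝ} (ht : t ∈ Ioc 0 T)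
    (hab : ∀ s ∈ Ioc 0 T, a s = b s) (hfg : f =ᵐ[volume.restrict (Ioc 0 T)] g) :
    volterra a f t = volterra b g t := by
  -- The endpoint `s = t` is discarded: there the kernels are evaluated at `0`, where they need not
  -- agree.
  rw [volterra, volterra, intervalIntegral.integral_of_le ht.1.le,
    intervalIntegral.integral_of_le ht.1.le, integral_Ioc_eq_integral_Ioo,
    integral_Ioc_eq_integral_Ioo]
  refine integral_congr_ae ?_
  filter_upwards [ae_restrict_mem measurableSet_Ioo,
    ae_restrict_of_ae_restrict_of_subset
      (fun s (hs : s ∈ Ioo 0 t) => (⟨hs.1, hs.2.le.trans ht.2⟩ : s ∈ Ioc 0 T)) hfg] with s hs h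
  rw [h, hab (t - s) ⟨sub_pos.2 hs.2, by linarith [hs.1, ht.2]⟩]

theorem convolution_eq_volterra {a : ℝ → ℝ} {f : ℝ → E} (ha : ∀ s ≤ 0, a s = 0)
    (hf : ∀ s ≤ 0, f s = 0) {t : ℝ} (ht : 0 ≤ t) :
    (a ⋆[ContinuousLinearMap.lsmul ℝ ℝ] f) t = volterra a f t := by
  rw [convolution_eq_swap, volterra, intervalIntegral.integral_of_le ht,
    ← integral_indicator measurableSet_Ioc]
  congr 1
  ext s
  by_cases h : s ∈ Ioc 0 t
  · simp [h]
  · rw [indicator_of_notMem h]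
    by_cases h0 : s ≤ 0
    · simp [hf s h0]
    · simp [ha (t - s) (by linarith [not_le.1 fun h' => h ⟨not_le.1 h0, h'⟩])]

theorem convolution_eq_zero_of_nonpos {a : ℝ → ℝ} {f : ℝ → E} (ha : ∀ s ≤ 0, a s = 0)
    (hf : ∀ s ≤ 0, f s = 0) {t : ℝ} (ht : t ≤ 0) :
    (a ⋆[ContinuousLinearMap.lsmul ℝ ℝ] f) t = 0 := by
  rw [convolution_eq_swap]
  refine (integral_congr_ae (Filter.Eventually.of_forall fun s => ?_)).trans (integral_zero ℝ E)
  by_cases h0 : s ≤ 0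
  · simp [hf s h0]
  · simp [ha (t - s) (by linarith [not_le.1 h0])]

theorem indicator_Ioc_nonpos {β : Type*} [Zero β] (f : ℝ → β) (T : ℝ) :
    ∀ s ≤ 0, (Ioc 0 T).indicator f s = 0 :=
  fun _ hs => indicator_of_notMem (fun h => not_lt.2 hs h.1) _

/-- On `(0, T]` a Volterra convolution is a convolution of functions on the line. -/
theorem convolution_indicator {a : ℝ → ℝ} {f : ℝ → E} {T t : ℝ} (ht : t ∈ Ioc 0 T) :
    ((Ioc 0 T).indicator a ⋆[ContinuousLinearMap.lsmul ℝ ℝ] (Ioc 0 T).indicator f) t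
      = volterra a f t := by
  rw [convolution_eq_volterra (indicator_Ioc_nonpos a T) (indicator_Ioc_nonpos f T) ht.1.le]
  exact volterra_congr ht (fun s hs => indicator_of_mem hs a)
    (by filter_upwards [ae_restrict_mem measurableSet_Ioc] with s hs using indicator_of_mem hs f)

variable {T : ℝ} {a b : ℝ → ℝ} {f g : ℝ → E}

theorem integrableOn_volterra (ha : IntegrableOn a (Ioc 0 T) volume)
    (hf : IntegrableOn f (Ioc 0 T) volume) :
    IntegrableOn (volterra a f) (Ioc 0 T) := by
  have := ((integrable_indicator_iff measurableSet_Ioc).2 ha).integrable_convolution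
    (ContinuousLinearMap.lsmul ℝ ℝ) ((integrable_indicator_iff measurableSet_Ioc).2 hf)
  exact this.integrableOn.congr_fun (fun t ht => convolution_indicator ht) measurableSet_Ioc

/-- By Fubini the integrand is integrable for almost every `t` only. This is why the linearity and
associativity rules below are almost-everywhere statements. -/
theorem ae_intervalIntegrable_volterra (ha : IntegrableOn a (Ioc 0 T) volume)
    (hf : IntegrableOn f (Ioc 0 T) volume) :
    ∀ᵐ t ∂volume.restrict (Ioc 0 T),
      IntervalIntegrable (fun s => a (t - s) • f s) volume 0 t := by
  have := ((integrable_indicator_iff measurableSet_Ioc).2 ha).ae_convolution_exists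
    (ContinuousLinearMap.lsmul ℝ ℝ) ((integrable_indicator_iff measurableSet_Ioc).2 hf)
  filter_upwards [ae_restrict_of_ae this, ae_restrict_mem measurableSet_Ioc] with t h ht
  have h' := h.integrable_swap
  rw [intervalIntegrable_iff_integrableOn_Ioo_of_le ht.1.le]
  refine (h'.integrableOn (s := Ioo 0 t)).congr_fun (fun s hs => ?_) measurableSet_Ioo
  have h2 : s ∈ Ioc 0 T := ⟨hs.1, hs.2.le.trans ht.2⟩
  have h3 : t - s ∈ Ioc 0 T := ⟨sub_pos.2 hs.2, by linarith [hs.1, ht.2]⟩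
  simp [h2, h3]

theorem eLpNorm_volterra_le (ha : IntegrableOn a (Ioc 0 T) volume)
    (hf : IntegrableOn f (Ioc 0 T) volume) :
    eLpNorm (volterra a f) 2 (volume.restrict (Ioc 0 T))
      ≤ (∫⁻ s in Ioc 0 T, ‖a s‖ₑ) * eLpNorm f 2 (volume.restrict (Ioc 0 T)) := by
  have h := eLpNorm_convolution_le ((integrable_indicator_iff measurableSet_Ioc).2 ha).1
    ((integrable_indicator_iff measurableSet_Ioc).2 hf).1
  rw [eLpNorm_indicator_eq_eLpNorm_restrict measurableSet_Ioc] at h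
  simp only [enorm_indicator_eq_indicator_enorm] at h
  rw [lintegral_indicator measurableSet_Ioc] at h
  refine le_trans ?_ h
  refine (eLpNorm_congr_ae ?_).trans_le (eLpNorm_restrict_le _ _ _ (Ioc 0 T))
  filter_upwards [ae_restrict_mem measurableSet_Ioc] with t ht using (convolution_indicator ht).symm

theorem memLp_two_volterra (ha : IntegrableOn a (Ioc 0 T) volume)
    (hf : MemLp f 2 (volume.restrict (Ioc 0 T))) :
    MemLp (volterra a f) 2 (volume.restrict (Ioc 0 T)) := by
  have hf1 : IntegrableOn f (Ioc 0 T) := hf.integrable (by norm_num)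
  exact ⟨(integrableOn_volterra ha hf1).1, (eLpNorm_volterra_le ha hf1).trans_lt
    (ENNReal.mul_lt_top ha.2 hf.2)⟩

theorem volterra_volterra [CompleteSpace E] (ha : IntegrableOn a (Ioc 0 T) volume)
    (hb : IntegrableOn b (Ioc 0 T) volume)
    (hf : IntegrableOn f (Ioc 0 T) volume) :
    ∀ᵐ t ∂volume.restrict (Ioc 0 T),
      volterra a (volterra b f) t = volterra (volterra a b) f t := by
  have ia := (integrable_indicator_iff measurableSet_Ioc).2 ha
  have ib := (integrable_indicator_iff measurableSet_Ioc).2 hb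
  have jf := (integrable_indicator_iff measurableSet_Ioc).2 hf
  have hbf := ib.norm.integrable_convolution (ContinuousLinearMap.mul ℝ ℝ) jf.norm
  filter_upwards [ae_restrict_of_ae
    (ia.norm.ae_convolution_exists (ContinuousLinearMap.mul ℝ ℝ) hbf),
    ae_restrict_mem measurableSet_Ioc] with t h ht
  have A := convolution_assoc (ContinuousLinearMap.lsmul ℝ ℝ : ℝ →L[ℝ] ℝ →L[ℝ] ℝ)
    (ContinuousLinearMap.lsmul ℝ ℝ : ℝ →L[ℝ] E →L[ℝ] E) (ContinuousLinearMap.lsmul ℝ ℝ)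
    (ContinuousLinearMap.lsmul ℝ ℝ) (fun x y z => mul_smul x y z) ia.1 ib.1 jf.1
    (ia.ae_convolution_exists _ ib)
    (ib.norm.ae_convolution_exists (ContinuousLinearMap.mul ℝ ℝ) jf.norm) h
  -- The inner convolutions need not vanish beyond `T`, but they vanish for `s ≤ 0`, and values
  -- beyond `t ≤ T` do not enter.
  rw [convolution_eq_volterra (fun s hs => convolution_eq_zero_of_nonpos
      (indicator_Ioc_nonpos a T) (indicator_Ioc_nonpos b T) hs) (indicator_Ioc_nonpos f T) ht.1.le,
    convolution_eq_volterra (indicator_Ioc_nonpos a T) (fun s hs => convolution_eq_zero_of_nonpos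
      (indicator_Ioc_nonpos b T) (indicator_Ioc_nonpos f T) hs) ht.1.le] at A
  rw [volterra_congr ht (fun s hs => convolution_indicator hs)
      (by filter_upwards [ae_restrict_mem measurableSet_Ioc] with s hs using indicator_of_mem hs f),
    volterra_congr ht (fun s hs => indicator_of_mem hs a) (g := volterra b f)
      (by filter_upwards [ae_restrict_mem measurableSet_Ioc] with s hs
            using convolution_indicator hs)] at A
  exact A.symm

theorem volterra_comm (a b : ℝ → ℝ) (t : ℝ) : volterra a b t = volterra b a t := by
  have := intervalIntegral.integral_comp_sub_left (a := 0) (b := t)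
    (fun s => a (t - s) * b s) t
  simp only [volterra, smul_eq_mul]
  simp only [sub_sub_cancel, sub_self, sub_zero] at this
  rw [← this]
  exact intervalIntegral.integral_congr fun s _ => mul_comm _ _

theorem ContinuousLinearMap.ae_volterra_comp [CompleteSpace E] [CompleteSpace F] (L : E →L[ℝ] F)
    (ha : IntegrableOn a (Ioc 0 T) volume) (hf : IntegrableOn f (Ioc 0 T) volume) :
    ∀ᵐ t ∂volume.restrict (Ioc 0 T), volterra a (fun s => L (f s)) t = L (volterra a f t) := by
  filter_upwards [ae_intervalIntegrable_volterra ha hf] with t h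
  rw [volterra, volterra, ← L.intervalIntegral_comp_comm h]
  simp

theorem ae_volterra_add (ha : IntegrableOn a (Ioc 0 T) volume) (hf : IntegrableOn f (Ioc 0 T) volume)
    (hg : IntegrableOn g (Ioc 0 T) volume) :
    ∀ᵐ t ∂volume.restrict (Ioc 0 T), volterra a (f + g) t = volterra a f t + volterra a g t := by
  filter_upwards [ae_intervalIntegrable_volterra ha hf, ae_intervalIntegrable_volterra ha hg]
    with t h1 h2
  simp only [volterra, Pi.add_apply, smul_add]
  exact intervalIntegral.integral_add h1 h2

theorem ae_volterra_add_kernel (ha : IntegrableOn a (Ioc 0 T) volume) (hb : IntegrableOn b (Ioc 0 T) volume)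
    (hf : IntegrableOn f (Ioc 0 T) volume) :
    ∀ᵐ t ∂volume.restrict (Ioc 0 T), volterra (a + b) f t = volterra a f t + volterra b f t := by
  filter_upwards [ae_intervalIntegrable_volterra ha hf, ae_intervalIntegrable_volterra hb hf]
    with t h1 h2
  simp only [volterra, Pi.add_apply, add_smul]
  exact intervalIntegral.integral_add h1 h2

theorem volterra_smul (c : ℝ) (a : ℝ → ℝ) (f : ℝ → E) (t : ℝ) :
    volterra a (c • f) t = c • volterra a f t := by
  simp only [volterra, Pi.smul_apply, smul_comm _ c]
  exact intervalIntegral.integral_smul _ _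

theorem volterra_smul_kernel (c : ℝ) (a : ℝ → ℝ) (f : ℝ → E) (t : ℝ) :
    volterra (c • a) f t = c • volterra a f t := by
  simp only [volterra, Pi.smul_apply, smul_eq_mul, mul_smul]
  exact intervalIntegral.integral_smul _ _

end Volterra

/-! ### Riemann–Liouville kernels. -/

section Kernel

/-- The Riemann--Liouville kernel `t^(β - 1) / Γ(β)`. -/
noncomputable def rlKernel (β t : ℝ) : ℝ := t ^ (β - 1) / Real.Gamma β

theorem rlIntegral_eq_volterra (β : ℝ) (f : ℝ → ℝ) : rlIntegral β f = volterra (rlKernel β) f := rfl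

theorem rlKernel_one (t : ℝ) : rlKernel 1 t = 1 := by simp [rlKernel]

theorem volterra_rlKernel_one {E : Type*} [NormedAddCommGroup E] [NormedSpace ℝ E] (f : ℝ → E)
    (t : ℝ) : volterra (rlKernel 1) f t = ∫ s in (0 : ℝ)..t, f s := by
  simp [volterra, rlKernel_one]

theorem integrableOn_rlKernel {β : ℝ} (hβ : 0 < β) (T : ℝ) :
    IntegrableOn (rlKernel β) (Ioc 0 T) := by
  by_cases hT : 0 ≤ T
  · have := (intervalIntegral.intervalIntegrable_rpow' (a := 0) (b := T)
      (r := β - 1) (by linarith)).div_const (Real.Gamma β)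
    rwa [intervalIntegrable_iff_integrableOn_Ioc_of_le hT] at this
  · rw [Ioc_eq_empty (by simpa using le_of_not_ge hT)]
    exact integrableOn_empty

/-- The Beta integral, `B(β, α) = Γ(β) Γ(α) / Γ(β + α)`, rescaled to `(0, t)`. With associativity it
yields the semigroup law; the case `α + β = 1` is what links `I^α`, `I^(1-α)` and integration. -/
theorem volterra_rlKernel {α β t : ℝ} (hα : 0 < α) (hβ : 0 < β) (ht : 0 < t) :
    volterra (rlKernel α) (rlKernel β) t = rlKernel (α + β) t := by
  have h := Complex.betaIntegral_scaled β α ht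
  have h2 := Complex.Gamma_mul_Gamma_eq_betaIntegral (s := β) (t := α) (by simpa) (by simpa)
  have hΓ : Complex.Gamma (β + α) ≠ 0 := by
    rw [← Complex.ofReal_add, Complex.Gamma_ofReal]
    exact_mod_cast (Real.Gamma_pos_of_pos (by positivity)).ne'
  have h3 : (∫ x in (0 : ℝ)..t, x ^ (β - 1) * (t - x) ^ (α - 1) : ℝ)
      = t ^ (β + α - 1) * (Real.Gamma β * Real.Gamma α / Real.Gamma (β + α)) := by
    apply Complex.ofReal_injective
    rw [← intervalIntegral.integral_ofReal]
    push_cast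
    rw [Complex.ofReal_cpow ht.le, ← Complex.Gamma_ofReal, ← Complex.Gamma_ofReal,
      ← Complex.Gamma_ofReal]
    push_cast
    rw [h2, mul_div_cancel_left₀ _ hΓ, ← h]
    refine intervalIntegral.integral_congr fun x hx => ?_
    rw [uIcc_of_le ht.le] at hx
    rw [Complex.ofReal_cpow hx.1, Complex.ofReal_cpow (sub_nonneg.2 hx.2)]
    push_cast
    rfl
  have e : volterra (rlKernel α) (rlKernel β) t = (Real.Gamma α * Real.Gamma β)⁻¹ *
      ∫ x in (0 : ℝ)..t, x ^ (β - 1) * (t - x) ^ (α - 1) := by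
    rw [← intervalIntegral.integral_const_mul]
    refine intervalIntegral.integral_congr fun x _ => ?_
    simp only [rlKernel, smul_eq_mul]
    field_simp
  have h4 := (Real.Gamma_pos_of_pos hα).ne'
  have h5 := (Real.Gamma_pos_of_pos hβ).ne'
  rw [e, h3, rlKernel, add_comm β α]
  field_simp

end Kernel

/-! ### Volterra operators on `L²(0, T; E)`. -/

section VolterraL

variable {E F : Type*} [NormedAddCommGroup E] [NormedSpace ℝ E]
  [NormedAddCommGroup F] [NormedSpace ℝ F] {T : ℝ} {a b : ℝ → ℝ}

/-- `L²(0, T; E)`. -/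
abbrev L2Time (T : ℝ) (E : Type*) [NormedAddCommGroup E] : Type _ :=
  Lp E 2 (volume.restrict (Ioc 0 T))

theorem L2Time.integrableOn {E : Type*} [NormedAddCommGroup E] (f : L2Time T E) : IntegrableOn f (Ioc 0 T) :=
  (Lp.memLp f).integrable (by norm_num)

/-- The Volterra convolution as an operator on `L²(0, T; E)`. -/
noncomputable def volterraL (E : Type*) [NormedAddCommGroup E] [NormedSpace ℝ E]
    (ha : IntegrableOn a (Ioc 0 T) volume) : L2Time T E →L[ℝ] L2Time T E :=
  LinearMap.mkContinuous
    { toFun := fun f => (memLp_two_volterra ha (Lp.memLp f)).toLp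
      map_add' := fun f g => by
        refine Lp.ext ?_
        refine (MemLp.coeFn_toLp _).trans ?_
        filter_upwards [Lp.coeFn_add ((memLp_two_volterra ha (Lp.memLp f)).toLp)
          ((memLp_two_volterra ha (Lp.memLp g)).toLp), (memLp_two_volterra ha (Lp.memLp f)).coeFn_toLp,
          (memLp_two_volterra ha (Lp.memLp g)).coeFn_toLp,
          ae_volterra_add ha f.integrableOn g.integrableOn, ae_restrict_mem measurableSet_Ioc]
          with t h1 h2 h3 h4 ht
        rw [h1, Pi.add_apply, h2, h3, ← h4]
        exact volterra_congr ht (fun _ _ => rfl) (Lp.coeFn_add f g)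
      map_smul' := fun c f => by
        refine Lp.ext ?_
        refine (MemLp.coeFn_toLp _).trans ?_
        filter_upwards [Lp.coeFn_smul c ((memLp_two_volterra ha (Lp.memLp f)).toLp),
          (memLp_two_volterra ha (Lp.memLp f)).coeFn_toLp, ae_restrict_mem measurableSet_Ioc]
          with t h1 h2 ht
        rw [RingHom.id_apply, h1, Pi.smul_apply, h2, ← volterra_smul]
        exact volterra_congr ht (fun _ _ => rfl) (Lp.coeFn_smul c f) }
    (∫ s in Ioc 0 T, |a s|) fun f => by
      have h0 : (0 : ℝ) ≤ ∫ s in Ioc 0 T, |a s| := integral_nonneg fun _ => abs_nonneg _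
      simp only [LinearMap.coe_mk, AddHom.coe_mk]
      rw [Lp.norm_toLp, Lp.norm_def, ← ENNReal.toReal_ofReal h0, ← ENNReal.toReal_mul]
      refine ENNReal.toReal_mono (ENNReal.mul_ne_top ENNReal.ofReal_ne_top (Lp.eLpNorm_ne_top f)) ?_
      refine (eLpNorm_volterra_le ha f.integrableOn).trans_eq ?_
      congr 1
      exact (ofReal_integral_norm_eq_lintegral_enorm ha).symm

theorem coeFn_volterraL (ha : IntegrableOn a (Ioc 0 T) volume) (f : L2Time T E) :
    volterraL E ha f =ᵐ[volume.restrict (Ioc 0 T)] volterra a f :=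
  (memLp_two_volterra ha (Lp.memLp f)).coeFn_toLp

theorem norm_volterraL_le (ha : IntegrableOn a (Ioc 0 T) volume) (f : L2Time T E) :
    ‖volterraL E ha f‖ ≤ (∫ s in Ioc 0 T, |a s|) * ‖f‖ :=
  ContinuousLinearMap.le_of_opNorm_le _ (LinearMap.mkContinuous_norm_le _
    (integral_nonneg fun _ => abs_nonneg _) _) f

theorem volterraL_congr (ha : IntegrableOn a (Ioc 0 T) volume) (hb : IntegrableOn b (Ioc 0 T) volume)
    (h : ∀ t ∈ Ioc 0 T, a t = b t) (f : L2Time T E) : volterraL E ha f = volterraL E hb f := by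
  refine Lp.ext ?_
  filter_upwards [coeFn_volterraL ha f, coeFn_volterraL hb f, ae_restrict_mem measurableSet_Ioc]
    with t h1 h2 ht
  rw [h1, h2]
  exact volterra_congr ht h .rfl

theorem volterraL_volterraL [CompleteSpace E] (ha : IntegrableOn a (Ioc 0 T) volume)
    (hb : IntegrableOn b (Ioc 0 T) volume) (f : L2Time T E) :
    volterraL E ha (volterraL E hb f) = volterraL E (integrableOn_volterra ha hb) f := by
  refine Lp.ext ?_
  filter_upwards [coeFn_volterraL ha (volterraL E hb f),
    coeFn_volterraL (integrableOn_volterra ha hb) f, volterra_volterra ha hb f.integrableOn,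
    ae_restrict_mem measurableSet_Ioc] with t h1 h2 h3 ht
  rw [h1, h2, ← h3]
  exact volterra_congr ht (fun _ _ => rfl) (coeFn_volterraL hb f)

theorem volterraL_comm [CompleteSpace E] (ha : IntegrableOn a (Ioc 0 T) volume)
    (hb : IntegrableOn b (Ioc 0 T) volume) (f : L2Time T E) :
    volterraL E ha (volterraL E hb f) = volterraL E hb (volterraL E ha f) := by
  rw [volterraL_volterraL, volterraL_volterraL]
  exact volterraL_congr _ _ (fun t _ => volterra_comm a b t) f

theorem volterraL_linear_kernel {c : ℝ → ℝ} {p q : ℝ} (ha : IntegrableOn a (Ioc 0 T) volume)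
    (hb : IntegrableOn b (Ioc 0 T) volume) (hc : IntegrableOn c (Ioc 0 T) volume)
    (h : ∀ t ∈ Ioc 0 T, c t = p * a t + q * b t) (f : L2Time T E) :
    volterraL E hc f = p • volterraL E ha f + q • volterraL E hb f := by
  refine Lp.ext ?_
  filter_upwards [coeFn_volterraL ha f, coeFn_volterraL hb f, coeFn_volterraL hc f,
    Lp.coeFn_add (p • volterraL E ha f) (q • volterraL E hb f),
    Lp.coeFn_smul p (volterraL E ha f), Lp.coeFn_smul q (volterraL E hb f),
    ae_volterra_add_kernel (ha.smul p) (hb.smul q) f.integrableOn,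
    ae_restrict_mem measurableSet_Ioc] with t h1 h2 h3 h4 h5 h6 h7 ht
  rw [h3, h4, Pi.add_apply, h5, h6, Pi.smul_apply, Pi.smul_apply, h1, h2, ← volterra_smul_kernel,
    ← volterra_smul_kernel, ← h7]
  exact volterra_congr ht h .rfl

/-- A scalar convolution in time commutes with an operator acting in space. This turns pairings in
`V` into pairings of `J w` or `G w`. -/
theorem compLpL_volterraL [CompleteSpace E] [CompleteSpace F] (L : E →L[ℝ] F)
    (ha : IntegrableOn a (Ioc 0 T) volume) (f : L2Time T E) :
    L.compLpL 2 _ (volterraL E ha f) = volterraL F ha (L.compLpL 2 _ f) := by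
  refine Lp.ext ?_
  filter_upwards [L.coeFn_compLpL (volterraL E ha f), coeFn_volterraL ha f,
    coeFn_volterraL ha (L.compLpL 2 _ f), L.ae_volterra_comp ha f.integrableOn,
    ae_restrict_mem measurableSet_Ioc] with t h1 h2 h3 h4 ht
  rw [h1, h2, h3, ← h4]
  exact volterra_congr ht (fun _ _ => rfl) (L.coeFn_compLpL f).symm

/-- A function whose primitive vanishes is zero. -/
theorem ae_eq_zero_of_primitive [CompleteSpace E] {f : ℝ → E} (hf : IntegrableOn f (Ioc 0 T) volume)
    (h : ∀ᵐ t ∂volume.restrict (Ioc 0 T), ∫ s in (0 : ℝ)..t, f s = 0) :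
    f =ᵐ[volume.restrict (Ioc 0 T)] 0 := by
  rcases le_or_gt T 0 with hT | hT
  · simp [Ioc_eq_empty (not_lt.2 hT), Filter.EventuallyEq]
  have hi : IntervalIntegrable f volume 0 T :=
    (intervalIntegrable_iff_integrableOn_Ioc_of_le hT.le).2 hf
  have hc : ContinuousOn (fun t => ∫ s in (0 : ℝ)..t, f s) (Icc 0 T) := by
    have := intervalIntegral.continuousOn_primitive_interval' hi left_mem_uIcc
    rwa [uIcc_of_le hT.le] at this
  -- Continuity upgrades vanishing almost everywhere to vanishing throughout the open interval;
  -- Lebesgue differentiation then finishes.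
  have h0 : EqOn (fun t => ∫ s in (0 : ℝ)..t, f s) (fun _ => 0) (Ioo 0 T) := by
    refine Measure.eqOn_open_of_ae_eq (μ := volume) ?_ isOpen_Ioo (hc.mono Ioo_subset_Icc_self)
      continuousOn_const
    exact ae_restrict_of_ae_restrict_of_subset Ioo_subset_Ioc_self h
  rw [restrict_Ioo_eq_restrict_Ioc.symm]
  have hd := hi.ae_hasDerivAt_integral
  filter_upwards [ae_restrict_of_ae hd, ae_restrict_mem measurableSet_Ioo] with t h1 ht
  have h2 := h1 (by rw [uIcc_of_le hT.le]; exact Ioo_subset_Icc_self ht) 0 left_mem_uIcc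
  refine h2.unique ?_
  refine (hasDerivAt_const t (0 : E)).congr_of_eventuallyEq ?_
  exact Filter.eventuallyEq_of_mem (isOpen_Ioo.mem_nhds ht) h0

end VolterraL

/-! ### Coercivity of fractional integration. -/

section Positivity

open Filter Topology

variable {E : Type*} [NormedAddCommGroup E] [InnerProductSpace ℝ E] [CompleteSpace E]
  {T : ℝ} {a : ℝ → ℝ}

/-- The integration operator `f ↦ ∫₀ᵗ f` on `L²(0, T; E)`. -/
noncomputable def primitiveL (T : ℝ) (E : Type*) [NormedAddCommGroup E] [NormedSpace ℝ E] :
    L2Time T E →L[ℝ] L2Time T E :=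
  volterraL E (integrableOn_rlKernel one_pos T)

theorem coeFn_primitiveL {E : Type*} [NormedAddCommGroup E] [NormedSpace ℝ E] (f : L2Time T E) :
    primitiveL T E f =ᵐ[volume.restrict (Ioc 0 T)] fun t => ∫ s in (0 : ℝ)..t, f s := by
  filter_upwards [coeFn_volterraL (integrableOn_rlKernel one_pos T) f] with t h
  rw [primitiveL, h, volterra_rlKernel_one]

theorem primitiveL_eq_zero {f : L2Time T E} (h : primitiveL T E f = 0) : f = 0 := by
  refine (Lp.eq_zero_iff_ae_eq_zero).2 (ae_eq_zero_of_primitive f.integrableOn ?_)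
  filter_upwards [coeFn_primitiveL f, Lp.coeFn_zero E 2 (volume.restrict (Ioc 0 T))] with t h1 h2
  rw [← h1, h, h2, Pi.zero_apply]

/-- Functions `φ(t) e` with `φ ∈ C_c^∞(0, T)` are primitives. A `q` orthogonal to all primitives is
therefore orthogonal to these, and the choice `e = ∫ φ q` gives `‖e‖² = 0`, so `q` vanishes as a
distribution. -/
theorem denseRange_primitiveL : DenseRange (primitiveL T E) := by
  suffices h : (LinearMap.range (primitiveL T E).toLinearMap).topologicalClosure = ⊤ by
    rw [DenseRange, dense_iff_closure_eq]
    have := congrArg (fun S : Submodule ℝ (L2Time T E) => (S : Set (L2Time T E))) h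
    rwa [Submodule.topologicalClosure_coe] at this
  rw [Submodule.topologicalClosure_eq_top_iff, Submodule.eq_bot_iff]
  intro q hq
  have hq' : ∀ η, inner ℝ (primitiveL T E η) q = 0 := fun η =>
    (Submodule.mem_orthogonal _ _).1 hq _ ⟨η, rfl⟩
  refine (Lp.eq_zero_iff_ae_eq_zero).2 ?_
  have hloc : LocallyIntegrableOn q (Ioo 0 T) (volume.restrict (Ioc 0 T)) :=
    (L2Time.integrableOn q).locallyIntegrable.locallyIntegrableOn _
  have key := isOpen_Ioo.ae_eq_zero_of_integral_contDiff_smul_eq_zero hloc fun φ hφ hc hs => by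
    set e := ∫ t, φ t • q t ∂volume.restrict (Ioc 0 T) with he
    have hd : Continuous (deriv φ) := hφ.continuous_deriv (by simp)
    have hi : Integrable (fun t => φ t • q t) (volume.restrict (Ioc 0 T)) := by
      obtain ⟨M, hM⟩ := hφ.continuous.bounded_above_of_compact_support hc
      exact (L2Time.integrableOn q).bdd_smul M hφ.continuous.aestronglyMeasurable
        (Eventually.of_forall hM)
    have hη : MemLp (fun t => deriv φ t • e) 2 (volume.restrict (Ioc 0 T)) :=
      ((hd.smul continuous_const).memLp_of_hasCompactSupport
        (hc.deriv.smul_right (f' := fun _ => e))).restrict _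
    have h0 : φ 0 = 0 := by
      by_contra h
      exact (lt_irrefl (0 : ℝ)) (hs (subset_tsupport _ h)).1
    have h1 : primitiveL T E hη.toLp =ᵐ[volume.restrict (Ioc 0 T)] fun t => φ t • e := by
      filter_upwards [coeFn_primitiveL hη.toLp, ae_restrict_mem measurableSet_Ioc] with t ht ht'
      rw [ht]
      have : ∫ s in (0 : ℝ)..t, hη.toLp _ s = ∫ s in (0 : ℝ)..t, deriv φ s • e := by
        refine intervalIntegral.integral_congr_ae_restrict ?_
        rw [uIoc_of_le ht'.1.le]
        exact ae_restrict_of_ae_restrict_of_subset (Ioc_subset_Ioc_right ht'.2) hη.coeFn_toLp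
      rw [this, intervalIntegral.integral_smul_const,
        intervalIntegral.integral_deriv_eq_sub
          (fun x _ => hφ.differentiable (by simp) x) (hd.intervalIntegrable _ _), h0, sub_zero]
    have h2 := hq' hη.toLp
    rw [L2.inner_def] at h2
    have h3 : ∫ t, inner ℝ (primitiveL T E hη.toLp t) (q t) ∂volume.restrict (Ioc 0 T)
        = ∫ t, inner ℝ e (φ t • q t) ∂volume.restrict (Ioc 0 T) := by
      refine integral_congr_ae ?_
      filter_upwards [h1] with t ht
      rw [ht, real_inner_smul_left, real_inner_smul_right]
    rw [h3, integral_inner hi, ← he, inner_self_eq_zero] at h2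
    exact h2
  have hI : ∀ᵐ t ∂volume.restrict (Ioc 0 T), t ∈ Ioo 0 T := by
    rw [← restrict_Ioo_eq_restrict_Ioc]
    exact ae_restrict_mem measurableSet_Ioo
  filter_upwards [key, hI] with t h ht using h ht

/-- The energy inequality for the integrated nonincreasing kernel `c(t) = K - ∫₀ᵗ m`. -/
theorem inner_volterraL_primitiveL_ge {m c : ℝ → ℝ} {K : ℝ} (hm : IntegrableOn m (Ioc 0 T) volume)
    (hm0 : ∀ t ∈ Ioc 0 T, 0 ≤ m t) (hc : IntegrableOn c (Ioc 0 T) volume)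
    (h : ∀ t ∈ Ioc 0 T, c t = K - ∫ s in (0 : ℝ)..t, m s) (y : L2Time T E) :
    (K - ∫ s in Ioc 0 T, m s) * ‖primitiveL T E y‖ ^ 2
      ≤ inner ℝ (volterraL E hc y) (primitiveL T E y) := by
  -- Since `c = K - 1 * m`, one has `c * y = K (1 * y) - m * (1 * y)`. Young's inequality bounds the
  -- last term by `‖m‖₁ ‖1 * y‖`, which leaves the coefficient `K - ‖m‖₁`.
  have h1 : volterraL E hc y
      = K • primitiveL T E y + (-1 : ℝ) • volterraL E hm (primitiveL T E y) := by
    rw [primitiveL, volterraL_volterraL]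
    refine volterraL_linear_kernel _ _ _ (fun t ht => ?_) y
    rw [h t ht, volterra_comm, volterra_rlKernel_one, rlKernel_one]
    ring
  have h2 := norm_volterraL_le hm (primitiveL T E y)
  have h3 : ∫ s in Ioc 0 T, |m s| = ∫ s in Ioc 0 T, m s :=
    setIntegral_congr_fun measurableSet_Ioc fun t ht => abs_of_nonneg (hm0 t ht)
  have h4 := real_inner_le_norm (volterraL E hm (primitiveL T E y)) (primitiveL T E y)
  rw [h1, inner_add_left, real_inner_smul_left, real_inner_smul_left, real_inner_self_eq_norm_sq]
  rw [h3] at h2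
  nlinarith [norm_nonneg (primitiveL T E y)]

theorem rlKernel_nonneg {β t : ℝ} (hβ : 0 < β) (ht : 0 ≤ t) : 0 ≤ rlKernel β t :=
  div_nonneg (Real.rpow_nonneg ht _) (Real.Gamma_pos_of_pos hβ).le

theorem rlKernel_anti {β s t : ℝ} (hβ : 0 < β) (hβ1 : β ≤ 1) (hs : 0 < s) (hst : s ≤ t) :
    rlKernel β t ≤ rlKernel β s :=
  div_le_div_of_nonneg_right (Real.rpow_le_rpow_of_nonpos hs hst (by linarith))
    (Real.Gamma_pos_of_pos hβ).le

theorem continuousOn_rlKernel (β : ℝ) : ContinuousOn (rlKernel β) (Ioi 0) :=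
  (ContinuousOn.rpow_const continuousOn_id fun _ h => Or.inl (ne_of_gt h)).div_const _

theorem hasDerivAt_rlKernel (β : ℝ) {t : ℝ} (ht : 0 < t) :
    HasDerivAt (rlKernel β) ((β - 1) * t ^ (β - 1 - 1) / Real.Gamma β) t :=
  (Real.hasDerivAt_rpow_const (Or.inl ht.ne')).div_const _

/-- The energy inequality for the Caputo derivative: `⟨k * y, 1 * y⟩ ≥ k(T) ‖1 * y‖²` for the
kernel `k(t) = t^(β - 1) / Γ(β)`, `0 < β < 1`. -/
theorem inner_rlKernel_primitiveL_ge {β : ℝ} (hβ : 0 < β) (hβ1 : β < 1) (hT : 0 < T)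
    (y : L2Time T E) :
    rlKernel β T * ‖primitiveL T E y‖ ^ 2
      ≤ inner ℝ (volterraL E (integrableOn_rlKernel hβ T) y) (primitiveL T E y) := by
  have hk := integrableOn_rlKernel hβ T
  have hcont : ∀ ε : ℝ, 0 < ε → ContinuousOn (fun s => rlKernel β (s + ε)) (Icc 0 T) := by
    intro ε hε
    exact (continuousOn_rlKernel β).comp (by fun_prop) fun s hs => add_pos_of_nonneg_of_pos hs.1 hε
  have hkε : ∀ ε : ℝ, 0 < ε → IntegrableOn (fun s => rlKernel β (s + ε)) (Ioc 0 T) volume :=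
    fun ε hε => ((hcont ε hε).integrableOn_Icc).mono_set Ioc_subset_Icc_self
  have step : ∀ ε : ℝ, ∀ hε : 0 < ε, rlKernel β (T + ε) * ‖primitiveL T E y‖ ^ 2
      ≤ inner ℝ (volterraL E (hkε ε hε) y) (primitiveL T E y) := by
    intro ε hε
    -- The shift by `ε` removes the singularity at `0`. Here `m` is minus the derivative of the
    -- shifted kernel, nonnegative as `β < 1`, and with `K = k(ε)` the coefficient `K - ‖m‖₁` is
    -- exactly `k(T + ε)`.
    set m : ℝ → ℝ := fun s => -((β - 1) * (s + ε) ^ (β - 1 - 1) / Real.Gamma β) with hm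
    have hmc : ContinuousOn m (Icc 0 T) := by
      refine ((ContinuousOn.const_mul ?_ _).div_const _).neg
      exact ContinuousOn.rpow_const (by fun_prop) fun s hs => Or.inl (by linarith [hs.1])
    have hmi : IntegrableOn m (Ioc 0 T) volume :=
      hmc.integrableOn_Icc.mono_set Ioc_subset_Icc_self
    have hFTC : ∀ t ∈ Ioc 0 T, ∫ s in (0 : ℝ)..t, m s = rlKernel β ε - rlKernel β (t + ε) := by
      intro t ht
      have := intervalIntegral.integral_eq_sub_of_hasDerivAt
        (f := fun s => - rlKernel β (s + ε)) (f' := m) (a := 0) (b := t) (fun s hs => by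
          rw [uIcc_of_le ht.1.le] at hs
          have := (hasDerivAt_rlKernel β (add_pos_of_nonneg_of_pos hs.1 hε)).comp_add_const s ε
          exact this.neg) (by
          rw [intervalIntegrable_iff_integrableOn_Ioc_of_le ht.1.le]
          exact hmi.mono_set (Ioc_subset_Ioc_right ht.2))
      rw [this]; simp; ring
    have := inner_volterraL_primitiveL_ge (K := rlKernel β ε) hmi (fun t ht => by
        have h1 := Real.Gamma_pos_of_pos hβ
        have h2 : 0 ≤ (t + ε) ^ (β - 1 - 1) := Real.rpow_nonneg (by linarith [ht.1]) _
        have : m t = (1 - β) * (t + ε) ^ (β - 1 - 1) / Real.Gamma β := by rw [hm]; ring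
        rw [this]
        exact div_nonneg (mul_nonneg (by linarith) h2) h1.le) (hkε ε hε) (fun t ht => by
        rw [hFTC t ht]; ring) y
    rwa [← intervalIntegral.integral_of_le hT.le, hFTC T ⟨hT, le_rfl⟩, sub_sub_cancel] at this
  set ε : ℕ → ℝ := fun n => 1 / ((n : ℝ) + 1) with hεdef
  have hε : ∀ n, 0 < ε n := fun n => by positivity
  have hε0 : Tendsto ε atTop (𝓝 0) := tendsto_one_div_add_atTop_nhds_zero_nat
  have hpt : ∀ t, 0 < t → Tendsto (fun n => rlKernel β (t + ε n)) atTop (𝓝 (rlKernel β t)) := by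
    intro t ht
    have := ((continuousOn_rlKernel β).continuousAt (Ioi_mem_nhds ht)).tendsto
    refine this.comp ?_
    simpa using hε0.const_add t
  have hL1 : Tendsto (fun n => ∫ s in Ioc 0 T, |rlKernel β (s + ε n) - rlKernel β s|) atTop
      (𝓝 0) := by
    -- As the kernel is nonnegative and decreasing, `|k(s + ε) - k(s)| ≤ k(s)`, and `k` itself is an
    -- integrable majorant.
    have := tendsto_integral_filter_of_dominated_convergence (l := atTop)
      (μ := volume.restrict (Ioc 0 T))
      (F := fun n s => |rlKernel β (s + ε n) - rlKernel β s|) (f := fun _ => 0) (rlKernel β)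
      (Eventually.of_forall fun n => ((hkε _ (hε n)).sub hk).1.norm)
      (Eventually.of_forall fun n => by
        filter_upwards [ae_restrict_mem measurableSet_Ioc] with s hs
        have h1 := rlKernel_anti hβ hβ1.le hs.1 (le_add_of_nonneg_right (hε n).le)
        have h2 := rlKernel_nonneg hβ (add_pos hs.1 (hε n)).le
        rw [Real.norm_eq_abs, abs_abs, abs_of_nonpos (by linarith)]
        linarith) hk (by
        filter_upwards [ae_restrict_mem measurableSet_Ioc] with s hs
        have := ((hpt s hs.1).sub_const (rlKernel β s)).abs
        simpa using this)
    simpa using this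
  have hS : Tendsto (fun n => volterraL E (hkε _ (hε n)) y) atTop (𝓝 (volterraL E hk y)) := by
    rw [tendsto_iff_norm_sub_tendsto_zero]
    refine squeeze_zero (fun _ => norm_nonneg _) (fun n => ?_)
      (by simpa using hL1.mul_const ‖y‖)
    have e : volterraL E (hkε _ (hε n)) y - volterraL E hk y
        = volterraL E ((hkε _ (hε n)).sub hk : IntegrableOn
            (fun s => rlKernel β (s + ε n) - rlKernel β s) (Ioc 0 T) volume) y := by
      rw [volterraL_linear_kernel (c := fun s => rlKernel β (s + ε n) - rlKernel β s) (p := 1) (q := -1) (hkε _ (hε n)) hk _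
        (fun t _ => by ring) y]
      simp [sub_eq_add_neg]
    rw [e]
    exact norm_volterraL_le _ y
  exact le_of_tendsto_of_tendsto' ((hpt T hT).mul_const _)
    (hS.inner tendsto_const_nhds) fun n => step _ (hε n)

/-- Coercivity of the Riemann--Liouville integral. -/
theorem inner_volterraL_rlKernel_ge {α : ℝ} (hα : 0 < α) (hα1 : α < 1) (hT : 0 < T)
    (h : L2Time T E) :
    rlKernel (1 - α) T * ‖volterraL E (integrableOn_rlKernel hα T) h‖ ^ 2
      ≤ inner ℝ h (volterraL E (integrableOn_rlKernel hα T) h) := by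
  set S := volterraL E (integrableOn_rlKernel hα T) with hS
  refine denseRange_primitiveL.induction_on
    (p := fun h => rlKernel (1 - α) T * ‖S h‖ ^ 2 ≤ inner ℝ h (S h)) h ?_ fun η => ?_
  · exact isClosed_le (by fun_prop) (by fun_prop)
  -- For `h = 1 * η` put `y = I^α η`. Then `I^(1-α) y = h` and `1 * y = I^α h`, so the claim is the
  -- energy inequality for the kernel of order `1 - α`.
  · have hβ : 0 < 1 - α := by linarith
    have h1 := inner_rlKernel_primitiveL_ge hβ (by linarith) hT (S η)
    have h2 : volterraL E (integrableOn_rlKernel hβ T) (S η) = primitiveL T E η := by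
      rw [hS, volterraL_volterraL, primitiveL]
      refine volterraL_congr _ _ (fun t ht => ?_) η
      rw [volterra_rlKernel hβ hα ht.1, sub_add_cancel]
    have h3 : primitiveL T E (S η) = S (primitiveL T E η) := volterraL_comm _ _ η
    rwa [h2, h3] at h1

/-- Applying `I^(1-α)` to `I^α h = 0` gives a vanishing primitive. -/
theorem volterraL_rlKernel_eq_zero {α : ℝ} (hα : 0 < α) (hα1 : α < 1) {h : L2Time T E}
    (h0 : volterraL E (integrableOn_rlKernel hα T) h = 0) : h = 0 := by
  have hβ : 0 < 1 - α := by linarith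
  refine primitiveL_eq_zero ?_
  have h2 : volterraL E (integrableOn_rlKernel hβ T) (volterraL E (integrableOn_rlKernel hα T) h)
      = primitiveL T E h := by
    rw [volterraL_volterraL, primitiveL]
    refine volterraL_congr _ _ (fun t ht => ?_) h
    rw [volterra_rlKernel hβ hα ht.1, sub_add_cancel]
  rw [← h2, h0, map_zero]

end Positivity

theorem Lp.norm_sq_eq_integral {X E : Type*} [MeasurableSpace X] {μ : Measure X}
    [NormedAddCommGroup E] [InnerProductSpace ℝ E] (f : Lp E 2 μ) :
    ‖f‖ ^ 2 = ∫ x, ‖f x‖ ^ 2 ∂μ := by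
  rw [← real_inner_self_eq_norm_sq, L2.inner_def]
  simp only [real_inner_self_eq_norm_sq]

/-! ### Control of `L²(0, T; V)` by `J` and `G`. -/

section Coercivity

open ContinuousLinearMap

variable {V H K : Type*} [NormedAddCommGroup V] [InnerProductSpace ℝ V]
  [NormedAddCommGroup H] [InnerProductSpace ℝ H] [NormedAddCommGroup K] [InnerProductSpace ℝ K]
  {T : ℝ}

theorem norm_sq_le_compLpL {J : V →L[ℝ] H} {G : V →L[ℝ] K} {M : ℝ}
    (hM : ∀ v, ‖v‖ ^ 2 ≤ M * (‖J v‖ ^ 2 + ‖G v‖ ^ 2)) (f : L2Time T V) :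
    ‖f‖ ^ 2 ≤ M * (‖(J.compLpL 2 _ f : L2Time T H)‖ ^ 2
      + ‖(G.compLpL 2 _ f : L2Time T K)‖ ^ 2) := by
  have i1 := (Lp.memLp (J.compLpL 2 _ f : L2Time T H)).integrable_norm_pow (by norm_num)
  have i2 := (Lp.memLp (G.compLpL 2 _ f : L2Time T K)).integrable_norm_pow (by norm_num)
  rw [Lp.norm_sq_eq_integral, Lp.norm_sq_eq_integral, Lp.norm_sq_eq_integral, ← integral_add i1 i2,
    ← integral_const_mul]
  refine integral_mono_ae ((Lp.memLp f).integrable_norm_pow (by norm_num))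
    ((i1.add i2).const_mul M) ?_
  filter_upwards [J.coeFn_compLpL f, G.coeFn_compLpL f] with t h1 h2
  simp only [h1, h2]
  exact hM _

theorem eq_zero_of_compLpL_eq_zero {J : V →L[ℝ] H} {G : V →L[ℝ] K} {M : ℝ}
    (hM : ∀ v, ‖v‖ ^ 2 ≤ M * (‖J v‖ ^ 2 + ‖G v‖ ^ 2))
    {f : L2Time T V} (hJ : (J.compLpL 2 _ f : L2Time T H) = 0)
    (hG : (G.compLpL 2 _ f : L2Time T K) = 0) : f = 0 := by
  have := norm_sq_le_compLpL hM f
  rw [hJ, hG] at this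
  simpa using this

end Coercivity

/-! ### The abstract equation: uniqueness, existence and energy. -/

section AbstractEquation

open Filter Topology ContinuousLinearMap

variable {V H K : Type*} [NormedAddCommGroup V] [InnerProductSpace ℝ V] [CompleteSpace V]
  [NormedAddCommGroup H] [InnerProductSpace ℝ H] [CompleteSpace H]
  [NormedAddCommGroup K] [InnerProductSpace ℝ K] [CompleteSpace K]
  {T α : ℝ}

theorem inner_compLpL_adjoint (A : V →L[ℝ] K) (f : L2Time T K) (g : L2Time T V) :
    inner ℝ ((adjoint A).compLpL 2 _ f : L2Time T V) g
      = inner ℝ f (A.compLpL 2 _ g : L2Time T K) := by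
  rw [L2.inner_def, L2.inner_def]
  refine integral_congr_ae ?_
  filter_upwards [(adjoint A).coeFn_compLpL f, A.coeFn_compLpL g] with t h1 h2
  rw [h1, h2, adjoint_inner_left]

theorem inner_adjoint_comp_compLpL (A : V →L[ℝ] K) (f g : L2Time T V) :
    inner ℝ ((adjoint A ∘L A).compLpL 2 _ f : L2Time T V) g
      = inner ℝ (A.compLpL 2 _ f : L2Time T K) (A.compLpL 2 _ g : L2Time T K) := by
  rw [← inner_compLpL_adjoint]
  congr 1
  refine Lp.ext ?_
  filter_upwards [(adjoint A).coeFn_compLpL (A.compLpL 2 _ f), A.coeFn_compLpL f,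
    (adjoint A ∘L A).coeFn_compLpL f] with t h1 h2 h3
  rw [h1, h2, h3, comp_apply]

/-- `w ∈ L²(0, T; V)` solves `J†J w + I^α (G†G w - p) = 0`, the integrated form of
`∂^α (J†J w) + G†G w = p` with zero initial value. -/
def IsVolterraSolution (J : V →L[ℝ] H) (G : V →L[ℝ] K) (hα : 0 < α) (p w : L2Time T V) : Prop :=
  (adjoint J ∘L J).compLpL 2 _ w
    = volterraL V (integrableOn_rlKernel hα T) (p - (adjoint G ∘L G).compLpL 2 _ w)

variable {J : V →L[ℝ] H} {G : V →L[ℝ] K} {M : ℝ} (hα : 0 < α)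

theorem inner_volterraL_pos (hα : 0 < α) (hα1 : α < 1) (hT : 0 < T)
    {h : L2Time T K} (h0 : inner ℝ h (volterraL K (integrableOn_rlKernel hα T) h) ≤ 0) :
    h = 0 := by
  have hk : 0 < rlKernel (1 - α) T := div_pos (Real.rpow_pos_of_pos hT _)
    (Real.Gamma_pos_of_pos (by linarith))
  have h1 := (inner_volterraL_rlKernel_ge hα hα1 hT h).trans h0
  refine volterraL_rlKernel_eq_zero hα hα1 ?_
  have h2 : ‖volterraL K (integrableOn_rlKernel hα T) h‖ ^ 2 ≤ 0 := by
    by_contra hc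
    nlinarith [not_le.1 hc]
  simpa using h2

theorem inner_volterraL_rlKernel_nonneg (hα1 : α < 1) (hT : 0 < T) (h : L2Time T K) :
    0 ≤ inner ℝ h (volterraL K (integrableOn_rlKernel hα T) h) := by
  refine le_trans ?_ (inner_volterraL_rlKernel_ge hα hα1 hT h)
  exact mul_nonneg (rlKernel_nonneg (by linarith) hT.le) (sq_nonneg _)

/-- Pairing the equation for the difference `f` with `f` gives `‖J f‖² + ⟨G f, I^α G f⟩ = 0`. Both
terms are nonnegative, so `J f = 0` and, by strict positivity of `I^α`, also `G f = 0`. -/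
theorem IsVolterraSolution.unique (hα1 : α < 1) (hT : 0 < T)
    (hM : ∀ v, ‖v‖ ^ 2 ≤ M * (‖J v‖ ^ 2 + ‖G v‖ ^ 2)) {p w₁ w₂ : L2Time T V}
    (h₁ : IsVolterraSolution J G hα p w₁) (h₂ : IsVolterraSolution J G hα p w₂) : w₁ = w₂ := by
  rw [← sub_eq_zero]
  set f := w₁ - w₂ with hf
  set S := volterraL V (integrableOn_rlKernel hα T) with hS
  have h : (adjoint J ∘L J).compLpL 2 _ f = - S ((adjoint G ∘L G).compLpL 2 _ f) := by
    rw [hf, map_sub, h₁, h₂]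
    simp only [map_sub, hS]
    abel
  have e1 := inner_adjoint_comp_compLpL J f f
  have e2 : inner ℝ (S ((adjoint G ∘L G).compLpL 2 _ f)) f
      = inner ℝ (G.compLpL 2 _ f : L2Time T K)
        (volterraL K (integrableOn_rlKernel hα T) (G.compLpL 2 _ f : L2Time T K)) := by
    rw [hS, ← compLpL_volterraL, inner_adjoint_comp_compLpL, compLpL_volterraL, real_inner_comm]
  rw [h, inner_neg_left, e2, real_inner_self_eq_norm_sq] at e1
  have h0 := inner_volterraL_rlKernel_nonneg hα hα1 hT (G.compLpL 2 _ f : L2Time T K)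
  have hJ : (J.compLpL 2 _ f : L2Time T H) = 0 := by
    have : ‖(J.compLpL 2 _ f : L2Time T H)‖ ^ 2 ≤ 0 := by linarith
    simpa using this
  refine eq_zero_of_compLpL_eq_zero hM hJ (inner_volterraL_pos hα hα1 hT ?_)
  rw [hJ] at e1
  simp only [norm_zero] at e1
  linarith

/-- For `w = I^α h` the equation holds with `p = J†J h + G†G I^α h`, and the energy inequality is
coercivity of `I^α` at `J h`. Density of such `p` and the resulting a priori bound carry both to a
general `p`. Existence and energy are proved together because the inequality is obtained along the
approximation. -/
theorem IsVolterraSolution.exists_and_energy (hα1 : α < 1) (hT : 0 < T)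
    (hM : ∀ v, ‖v‖ ^ 2 ≤ M * (‖J v‖ ^ 2 + ‖G v‖ ^ 2)) (p : L2Time T V) :
    ∃ w : L2Time T V, IsVolterraSolution J G hα p w ∧
      rlKernel (1 - α) T * ‖(J.compLpL 2 _ w : L2Time T H)‖ ^ 2
        ≤ inner ℝ (p - (adjoint G ∘L G).compLpL 2 _ w) w := by
  set S := volterraL V (integrableOn_rlKernel hα T) with hS
  set R : L2Time T V →L[ℝ] L2Time T V := (adjoint J ∘L J).compLpL 2 _ with hR
  set Q : L2Time T V →L[ℝ] L2Time T V := (adjoint G ∘L G).compLpL 2 _ with hQ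
  set k := rlKernel (1 - α) T with hk
  have hk0 : 0 < k := div_pos (Real.rpow_pos_of_pos hT _) (Real.Gamma_pos_of_pos (by linarith))
  -- `N h` is the right-hand side for which `S h` is a solution.
  set N : L2Time T V →L[ℝ] L2Time T V := R + Q ∘L S with hN
  have hRS : ∀ h, R (S h) = S (R h) := fun h => compLpL_volterraL _ _ h
  have hQS : ∀ h, Q (S h) = S (Q h) := fun h => compLpL_volterraL _ _ h
  have hsol : ∀ h, IsVolterraSolution J G hα (N h) (S h) := by
    intro h
    change R (S h) = S (N h - Q (S h))
    rw [hRS, hN]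
    simp
  have hen : ∀ h, k * ‖(J.compLpL 2 _ (S h) : L2Time T H)‖ ^ 2
      ≤ inner ℝ (N h - Q (S h)) (S h) := by
    intro h
    have e : N h - Q (S h) = R h := by rw [hN]; simp
    rw [e, hR, inner_adjoint_comp_compLpL, hS, compLpL_volterraL]
    exact inner_volterraL_rlKernel_ge hα hα1 hT _
  have hdense : DenseRange N := by
    suffices h : (LinearMap.range N.toLinearMap).topologicalClosure = ⊤ by
      rw [DenseRange, dense_iff_closure_eq]
      have := congrArg (fun S : Submodule ℝ (L2Time T V) => (S : Set (L2Time T V))) h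
      rwa [Submodule.topologicalClosure_coe] at this
    rw [Submodule.topologicalClosure_eq_top_iff, Submodule.eq_bot_iff]
    intro q hq
    -- Testing with `q` itself suffices: `⟨N q, q⟩ = ‖J q‖² + ⟨G q, I^α G q⟩` is strictly positive
    -- unless `q = 0`.
    have h1 : inner ℝ (N q) q = 0 := (Submodule.mem_orthogonal _ _).1 hq _ ⟨q, rfl⟩
    have h2 : inner ℝ (N q) q = ‖(J.compLpL 2 _ q : L2Time T H)‖ ^ 2
        + inner ℝ (G.compLpL 2 _ q : L2Time T K)
          (volterraL K (integrableOn_rlKernel hα T) (G.compLpL 2 _ q : L2Time T K)) := by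
      rw [hN, add_apply, comp_apply, inner_add_left, hR, hQ, inner_adjoint_comp_compLpL,
        inner_adjoint_comp_compLpL, real_inner_self_eq_norm_sq, hS, compLpL_volterraL,
        real_inner_comm]
    have h0 := inner_volterraL_rlKernel_nonneg hα hα1 hT (G.compLpL 2 _ q : L2Time T K)
    refine eq_zero_of_compLpL_eq_zero hM ?_ (inner_volterraL_pos hα hα1 hT ?_)
    · have : ‖(J.compLpL 2 _ q : L2Time T H)‖ ^ 2 ≤ 0 := by linarith
      simpa using this
    · nlinarith [sq_nonneg ‖(J.compLpL 2 _ q : L2Time T H)‖]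
  -- The energy inequality reads `k ‖J S h‖² + ‖G S h‖² ≤ ‖N h‖ ‖S h‖`; bounding the two terms
  -- separately produces `k⁻¹ + 1`.
  set M' := |M| * (k⁻¹ + 1) with hM'
  have hbound : ∀ h, ‖S h‖ ≤ M' * ‖N h‖ := by
    intro h
    have h1 := hen h
    rw [inner_sub_left, hQ, inner_adjoint_comp_compLpL, real_inner_self_eq_norm_sq] at h1
    have h2 := norm_sq_le_compLpL hM (S h)
    have h3 := real_inner_le_norm (N h) (S h)
    set x := ‖(J.compLpL 2 _ (S h) : L2Time T H)‖ ^ 2 with hx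
    set y := ‖(G.compLpL 2 _ (S h) : L2Time T K)‖ ^ 2 with hy
    have hx0 : 0 ≤ x := sq_nonneg _
    have hy0 : 0 ≤ y := sq_nonneg _
    set n := ‖N h‖ * ‖S h‖ with hn
    have hsum : k * x + y ≤ n := by linarith
    have h4 : x ≤ k⁻¹ * n := by
      rw [inv_mul_eq_div, le_div_iff₀ hk0]; linarith
    have h5 : y ≤ n := by nlinarith
    have h6 : ‖S h‖ ^ 2 ≤ M' * ‖N h‖ * ‖S h‖ := by
      calc _ ≤ M * (x + y) := h2
        _ ≤ |M| * (x + y) := mul_le_mul_of_nonneg_right (le_abs_self M) (by positivity)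
        _ ≤ |M| * (k⁻¹ * n + n) := by gcongr
        _ = _ := by rw [hM', hn]; ring
    rcases (norm_nonneg (S h)).eq_or_lt with h7 | h7
    · rw [← h7]; positivity
    · exact le_of_mul_le_mul_right (by rw [← sq]; exact h6) h7
  obtain ⟨x, hx, hxp⟩ := mem_closure_iff_seq_limit.1 (hdense p)
  choose h hh using hx
  have hp : Tendsto (fun n => N (h n)) atTop (𝓝 p) := by simpa only [hh] using hxp
  -- The sequence `h n` itself need not converge; the bound gives convergence of `S (h n)`, and the
  -- equation and inequality involve only `S (h n)` and `N (h n)`.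
  have hcau : CauchySeq fun n => S (h n) := by
    have hc := hp.cauchySeq
    rw [cauchySeq_iff_le_tendsto_0] at hc ⊢
    obtain ⟨b, hb0, hb1, hb2⟩ := hc
    refine ⟨fun n => M' * b n, fun n => mul_nonneg (by positivity) (hb0 n), fun n m l hn hm => ?_,
      by simpa using hb2.const_mul M'⟩
    rw [dist_eq_norm, ← map_sub]
    refine (hbound _).trans (mul_le_mul_of_nonneg_left ?_ (by positivity))
    rw [map_sub, ← dist_eq_norm]
    exact hb1 n m l hn hm
  obtain ⟨w, hw⟩ := cauchySeq_tendsto_of_complete hcau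
  refine ⟨w, ?_, ?_⟩
  · refine tendsto_nhds_unique_of_eventuallyEq (f := fun n => R (S (h n)))
      (g := fun n => S (N (h n) - Q (S (h n)))) (l := atTop) ?_ ?_
      (Eventually.of_forall fun n => hsol (h n))
    · exact (R.continuous.tendsto w).comp hw
    · exact (S.continuous.tendsto _).comp (hp.sub ((Q.continuous.tendsto w).comp hw))
  · refine le_of_tendsto_of_tendsto' (f := fun n => k * ‖(J.compLpL 2 _ (S (h n)) : L2Time T H)‖ ^ 2)
      (g := fun n => inner ℝ (N (h n) - Q (S (h n))) (S (h n))) (b := atTop) ?_ ?_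
      fun n => hen (h n)
    · exact ((((J.compLpL 2 _).continuous.tendsto w).comp hw).norm.pow 2).const_mul k
    · exact (hp.sub ((Q.continuous.tendsto w).comp hw)).inner hw

end AbstractEquation

/-! ### Primitives and multiplication by time. -/

section TimeIntegrals

open Filter Topology

theorem MemLp.mono_Ioc {E : Type*} [NormedAddCommGroup E] {f : ℝ → E} {t T : ℝ}
    (hf : MemLp f 2 (volume.restrict (Ioc 0 T))) (ht : t ≤ T) :
    MemLp f 2 (volume.restrict (Ioc 0 t)) :=
  hf.mono_measure (Measure.restrict_mono (Ioc_subset_Ioc_right ht) le_rfl)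

theorem MemLp.integrableOn_Ioc {E : Type*} [NormedAddCommGroup E] {f : ℝ → E} {T : ℝ}
    (hf : MemLp f 2 (volume.restrict (Ioc 0 T))) : IntegrableOn f (Ioc 0 T) volume :=
  hf.integrable (by norm_num)

theorem MemLp.intervalIntegrable_Ioc {E : Type*} [NormedAddCommGroup E] {f : ℝ → E} {t T : ℝ}
    (hf : MemLp f 2 (volume.restrict (Ioc 0 T))) (ht : t ∈ Ioc 0 T) :
    IntervalIntegrable f volume 0 t :=
  (intervalIntegrable_iff_integrableOn_Ioc_of_le ht.1.le).2
    (MemLp.integrableOn_Ioc (MemLp.mono_Ioc hf ht.2))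

theorem MemLp.clm_comp {E F : Type*} [NormedAddCommGroup E] [NormedSpace ℝ E]
    [NormedAddCommGroup F] [NormedSpace ℝ F] (L : E →L[ℝ] F) {f : ℝ → E} {T : ℝ}
    (hf : MemLp f 2 (volume.restrict (Ioc 0 T))) :
    MemLp (fun t => L (f t)) 2 (volume.restrict (Ioc 0 T)) :=
  L.comp_memLp' hf

theorem clm_primitive {E F : Type*} [NormedAddCommGroup E] [NormedSpace ℝ E] [CompleteSpace E]
    [NormedAddCommGroup F] [NormedSpace ℝ F] [CompleteSpace F] (L : E →L[ℝ] F) {f : ℝ → E}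
    {t T : ℝ} (hf : MemLp f 2 (volume.restrict (Ioc 0 T))) (ht : t ∈ Ioc 0 T) :
    ∫ s in (0 : ℝ)..t, L (f s) = L (∫ s in (0 : ℝ)..t, f s) :=
  L.intervalIntegral_comp_comm (MemLp.intervalIntegrable_Ioc hf ht)

variable {E : Type*} [NormedAddCommGroup E] [InnerProductSpace ℝ E] [CompleteSpace E] {T : ℝ}
  {f : ℝ → E}

/-- The variance of `f` about its mean over `(0, t)` is nonnegative. -/
theorem norm_integral_sq_le {t : ℝ} (ht : 0 < t) (hf : MemLp f 2 (volume.restrict (Ioc 0 t))) :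
    ‖∫ s in (0 : ℝ)..t, f s‖ ^ 2 ≤ t * ∫ s in (0 : ℝ)..t, ‖f s‖ ^ 2 := by
  rw [intervalIntegral.integral_of_le ht.le, intervalIntegral.integral_of_le ht.le]
  set I := ∫ s in Ioc 0 t, f s with hI
  have hf1 : Integrable f (volume.restrict (Ioc 0 t)) := MemLp.integrableOn_Ioc hf
  have h : 0 ≤ ∫ s in Ioc 0 t, ‖f s - t⁻¹ • I‖ ^ 2 := integral_nonneg fun _ => sq_nonneg _
  have e : ∫ s in Ioc 0 t, ‖f s - t⁻¹ • I‖ ^ 2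
      = (∫ s in Ioc 0 t, ‖f s‖ ^ 2) - 2 * (t⁻¹ * inner ℝ I I) + t * ‖t⁻¹ • I‖ ^ 2 := by
    have i1 := hf.integrable_norm_pow (p := 2) (by norm_num)
    have i2 : Integrable (fun s => 2 * inner ℝ (f s) (t⁻¹ • I)) (volume.restrict (Ioc 0 t)) :=
      (hf1.inner_const _).const_mul 2
    have : ∀ s, ‖f s - t⁻¹ • I‖ ^ 2
        = ‖f s‖ ^ 2 - 2 * inner ℝ (f s) (t⁻¹ • I) + ‖t⁻¹ • I‖ ^ 2 := fun s =>
      norm_sub_sq_real _ _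
    simp only [this]
    have i3 : Integrable (fun s => ‖f s‖ ^ 2 - 2 * inner ℝ (f s) (t⁻¹ • I))
        (volume.restrict (Ioc 0 t)) := i1.sub i2
    rw [integral_add i3 (integrable_const _), integral_sub i1 i2, integral_const_mul]
    congr 2
    · congr 2
      simp only [real_inner_comm (t⁻¹ • I)]
      rw [integral_inner hf1, real_inner_smul_left]
    · simp [ht.le]
  rw [e, norm_smul, real_inner_self_eq_norm_sq, mul_pow, Real.norm_eq_abs, sq_abs] at h
  have : t * (t⁻¹ ^ 2 * ‖I‖ ^ 2) = t⁻¹ * ‖I‖ ^ 2 := by field_simp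
  rw [this] at h
  have h2 : t⁻¹ * ‖I‖ ^ 2 ≤ ∫ s in Ioc 0 t, ‖f s‖ ^ 2 := by linarith
  rwa [inv_mul_le_iff₀ ht] at h2

theorem memLp_primitive {E : Type*} [NormedAddCommGroup E] [NormedSpace ℝ E] {f : ℝ → E}
    (hf : MemLp f 2 (volume.restrict (Ioc 0 T))) :
    MemLp (fun t => ∫ s in (0 : ℝ)..t, f s) 2 (volume.restrict (Ioc 0 T)) := by
  have := memLp_two_volterra (integrableOn_rlKernel one_pos T) hf
  exact this.congr_norm (this.1.congr (Eventually.of_forall fun t => volterra_rlKernel_one f t))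
    (Eventually.of_forall fun t => by rw [volterra_rlKernel_one])

theorem memLp_time_smul {E : Type*} [NormedAddCommGroup E] [NormedSpace ℝ E] {f : ℝ → E}
    (hf : MemLp f 2 (volume.restrict (Ioc 0 T))) :
    MemLp (fun t => t • f t) 2 (volume.restrict (Ioc 0 T)) := by
  refine MemLp.of_le_mul (c := T) hf (aestronglyMeasurable_id.smul hf.1) ?_
  filter_upwards [ae_restrict_mem measurableSet_Ioc] with t ht
  rw [norm_smul, Real.norm_of_nonneg ht.1.le]
  exact mul_le_mul_of_nonneg_right ht.2 (norm_nonneg _)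

theorem continuousOn_primitive_Icc {E : Type*} [NormedAddCommGroup E] [NormedSpace ℝ E] {f : ℝ → E}
    (hf : MemLp f 2 (volume.restrict (Ioc 0 T))) :
    ContinuousOn (fun t => ∫ s in (0 : ℝ)..t, f s) (Icc 0 T) := by
  rcases lt_or_ge T 0 with hT | hT
  · simp [Icc_eq_empty (not_le.2 hT)]
  have := intervalIntegral.continuousOn_primitive_interval' (a := 0) (b₁ := 0) (b₂ := T)
    ((intervalIntegrable_iff_integrableOn_Ioc_of_le hT).2 (MemLp.integrableOn_Ioc hf)) left_mem_uIcc
  rwa [uIcc_of_le hT] at this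

/-- If `t f(t)` has a weak derivative and `f` is integrable, then `t f(t)` vanishes at `0`. -/
theorem HasL2TimeDeriv.eq_primitive {E : Type*} [NormedAddCommGroup E] [NormedSpace ℝ E]
    {f : ℝ → E} (hT : 0 < T) (hf : MemLp f 2 (volume.restrict (Ioc 0 T)))
    {f' : ℝ → E} (h : HasL2TimeDeriv T (fun t => t • f t) f') :
    ∀ᵐ t ∂volume.restrict (Ioc 0 T), t • f t = ∫ s in (0 : ℝ)..t, f' s := by
  obtain ⟨c, hc⟩ := h.exists_const
  suffices h0 : c = 0 by simpa [h0] using hc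
  by_contra h0
  have hcont := continuousOn_primitive_Icc h.memLp
  have h1 : Tendsto (fun t => ∫ s in (0 : ℝ)..t, f' s) (𝓝[Icc 0 T] 0) (𝓝 0) := by
    simpa using (hcont 0 ⟨le_rfl, hT.le⟩).tendsto
  have hpos : 0 < ‖c‖ / 2 := by positivity
  have h2 := h1.norm.eventually_lt_const (u := ‖c‖ / 2) (by rwa [norm_zero])
  rw [eventually_nhdsWithin_iff, Metric.eventually_nhds_iff] at h2
  obtain ⟨ε, hε, h3⟩ := h2
  -- If `c ≠ 0`, then `‖f(t)‖ ≥ ‖c‖ / (2 t)` almost everywhere on `(0, δ]`, which contradicts the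
  -- integrability of `f` because `1/t` is not integrable at `0`.
  set δ := min (ε / 2) T with hδ
  have hδ0 : 0 < δ := lt_min (by linarith) hT
  have hint : IntegrableOn f (Ioc 0 δ) volume :=
    (MemLp.integrableOn_Ioc hf).mono_set (Ioc_subset_Ioc_right (min_le_right _ _))
  have hinv : IntegrableOn (fun t : ℝ => t⁻¹) (Ioc 0 δ) volume := by
    refine Integrable.mono' (hint.norm.const_mul (‖c‖ / 2)⁻¹)
      measurable_inv.aestronglyMeasurable ?_
    filter_upwards [ae_restrict_of_ae_restrict_of_subset
      (Ioc_subset_Ioc_right (min_le_right _ _)) hc, ae_restrict_mem measurableSet_Ioc]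
      with t ht ht'
    have h4 := h3 (y := t) (by
      rw [dist_zero_right, Real.norm_of_nonneg ht'.1.le]
      linarith [ht'.2, min_le_left (ε / 2) T]) ⟨ht'.1.le, ht'.2.trans (min_le_right _ _)⟩
    have h5 : ‖c‖ / 2 ≤ t * ‖f t‖ := by
      have h6 : ‖t • f t‖ = t * ‖f t‖ := by rw [norm_smul, Real.norm_of_nonneg ht'.1.le]
      rw [← h6, ht]
      have := norm_sub_norm_le c (-∫ s in (0 : ℝ)..t, f' s)
      rw [norm_neg, sub_neg_eq_add] at this
      linarith
    rw [Real.norm_of_nonneg (inv_nonneg.2 ht'.1.le), inv_mul_eq_div, le_div_iff₀ hpos,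
      inv_mul_le_iff₀ ht'.1]
    exact h5
  have := (intervalIntegrable_iff_integrableOn_Ioc_of_le hδ0.le).2 hinv
  rw [intervalIntegrable_inv_iff] at this
  rcases this with h | h
  · exact hδ0.ne h
  · exact h left_mem_uIcc

/-- The commutator of multiplication by time and the fractional integral:
`t I^α f = I^α (t f) + α I^α (∫₀ᵗ f)`. -/
theorem ae_smul_volterra_rlKernel {α : ℝ} (hα : 0 < α)
    (hf : MemLp f 2 (volume.restrict (Ioc 0 T))) :
    ∀ᵐ t ∂volume.restrict (Ioc 0 T), t • volterra (rlKernel α) f t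
      = volterra (rlKernel α) ((fun s => s • f s) + α • fun s => ∫ r in (0 : ℝ)..s, f r) t := by
  have hg := integrableOn_rlKernel hα T
  have h1 := integrableOn_rlKernel one_pos T
  have hf1 := MemLp.integrableOn_Ioc hf
  have htf := MemLp.integrableOn_Ioc (memLp_time_smul hf)
  have hI := MemLp.integrableOn_Ioc (memLp_primitive hf)
  filter_upwards [ae_volterra_add hg htf (hI.smul α), ae_intervalIntegrable_volterra hg hf1,
    ae_intervalIntegrable_volterra hg htf, volterra_volterra hg h1 hf1,
    ae_restrict_mem measurableSet_Ioc] with t e1 e2 e3 e4 ht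
  rw [e1, volterra_smul]
  have e5 : volterra (rlKernel α) (fun s => ∫ r in (0 : ℝ)..s, f r) t
      = volterra (rlKernel (α + 1)) f t := by
    rw [volterra_congr ht (fun s hs => (volterra_rlKernel hα one_pos hs.1).symm) .rfl, ← e4]
    exact volterra_congr ht (fun _ _ => rfl)
      (Eventually.of_forall fun s => (volterra_rlKernel_one f s).symm)
  rw [e5]
  -- Write `t = (t - s) + s` under the integral and use `r ω_α(r) = α ω_(α+1)(r)`, where `ω_β` is
  -- `rlKernel β`; by the semigroup law `ω_(α+1) * f` is `I^α` of the primitive of `f`.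
  have e6 : ∀ s ∈ uIcc 0 t, α • (rlKernel (α + 1) (t - s) • f s)
      = t • (rlKernel α (t - s) • f s) - rlKernel α (t - s) • s • f s := by
    intro s hs
    rw [uIcc_of_le ht.1.le] at hs
    have h6 : α * rlKernel (α + 1) (t - s) = (t - s) * rlKernel α (t - s) := by
      have hΓ := (Real.Gamma_pos_of_pos hα).ne'
      rw [rlKernel, rlKernel, Real.Gamma_add_one hα.ne', add_sub_cancel_right]
      rcases (sub_nonneg.2 hs.2).eq_or_lt with h0 | h0
      · rw [← h0, Real.zero_rpow hα.ne']; simp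
      · rw [Real.rpow_sub_one h0.ne']
        field_simp
    rw [smul_smul, h6, smul_smul, smul_smul, ← sub_smul]
    congr 1
    ring
  have e7 : α • volterra (rlKernel (α + 1)) f t
      = t • volterra (rlKernel α) f t - volterra (rlKernel α) (fun s => s • f s) t := by
    simp only [volterra]
    have e2' : IntervalIntegrable (fun s => t • rlKernel α (t - s) • f s) volume 0 t := e2.smul t
    rw [← intervalIntegral.integral_smul, ← intervalIntegral.integral_smul,
      ← intervalIntegral.integral_sub e2' e3]
    exact intervalIntegral.integral_congr e6
  rw [e7]
  abel

end TimeIntegrals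

/-! ### Solutions as functions of time. -/

section SolutionFunctions

open Filter Topology ContinuousLinearMap

variable {V H K : Type*} [NormedAddCommGroup V] [InnerProductSpace ℝ V] [CompleteSpace V]
  [NormedAddCommGroup H] [InnerProductSpace ℝ H] [CompleteSpace H]
  [NormedAddCommGroup K] [InnerProductSpace ℝ K] [CompleteSpace K]
  {T α : ℝ}

/-- The integrated form `J†J w = I^α (G† (η - G w))` of the equation
`∂^α ⟨J w, J v⟩ + ⟨G w, G v⟩ = ⟨η, G v⟩`, for functions of time. -/
def SolvesVolterra (J : V →L[ℝ] H) (G : V →L[ℝ] K) (α T : ℝ) (η : ℝ → K) (w : ℝ → V) : Prop :=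
  ∀ᵐ t ∂volume.restrict (Ioc 0 T),
    adjoint J (J (w t)) = volterra (rlKernel α) (fun s => adjoint G (η s - G (w s))) t

variable {J : V →L[ℝ] H} {G : V →L[ℝ] K} {M : ℝ} {η : ℝ → K} {w : ℝ → V}

theorem SolvesVolterra.mono {t : ℝ} (h : SolvesVolterra J G α T η w) (ht : t ≤ T) :
    SolvesVolterra J G α t η w :=
  ae_restrict_of_ae_restrict_of_subset (Ioc_subset_Ioc_right ht) h

/-- Existence and uniqueness are Hilbert space statements about classes, whereas primitives,
multiplication by `t` and restriction to `(0, t]` are handled on functions; this translates between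
the two. -/
theorem solvesVolterra_iff (hα : 0 < α) (p : L2Time T K) (u : L2Time T V)
    (hp : p =ᵐ[volume.restrict (Ioc 0 T)] η) (hu : u =ᵐ[volume.restrict (Ioc 0 T)] w) :
    SolvesVolterra J G α T η w
      ↔ IsVolterraSolution J G hα ((adjoint G).compLpL 2 _ p) u := by
  have h1 : (adjoint J ∘L J).compLpL 2 (volume.restrict (Ioc 0 T)) u
      =ᵐ[volume.restrict (Ioc 0 T)] fun t => adjoint J (J (w t)) := by
    filter_upwards [(adjoint J ∘L J).coeFn_compLpL u, hu] with t e1 e2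
    rw [e1, e2, comp_apply]
  have h2 : ((adjoint G).compLpL 2 _ p - (adjoint G ∘L G).compLpL 2 _ u : L2Time T V)
      =ᵐ[volume.restrict (Ioc 0 T)] fun t => adjoint G (η t - G (w t)) := by
    filter_upwards [Lp.coeFn_sub ((adjoint G).compLpL 2 _ p : L2Time T V)
      ((adjoint G ∘L G).compLpL 2 _ u), (adjoint G).coeFn_compLpL p,
      (adjoint G ∘L G).coeFn_compLpL u, hp, hu] with t e1 e2 e3 e4 e5
    rw [e1, Pi.sub_apply, e2, e3, e4, e5, comp_apply, map_sub]
  have h3 : volterraL V (integrableOn_rlKernel hα T)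
      ((adjoint G).compLpL 2 _ p - (adjoint G ∘L G).compLpL 2 _ u)
      =ᵐ[volume.restrict (Ioc 0 T)]
        volterra (rlKernel α) (fun s => adjoint G (η s - G (w s))) := by
    filter_upwards [coeFn_volterraL (integrableOn_rlKernel hα T)
      ((adjoint G).compLpL 2 _ p - (adjoint G ∘L G).compLpL 2 _ u),
      ae_restrict_mem measurableSet_Ioc] with t e1 ht
    rw [e1]
    exact volterra_congr ht (fun _ _ => rfl) h2
  rw [IsVolterraSolution, SolvesVolterra, Lp.ext_iff]
  constructor
  · intro h
    exact (h1.trans h).trans h3.symm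
  · intro h
    exact (h1.symm.trans h).trans h3

theorem SolvesVolterra.exists (hα : 0 < α) (hα1 : α < 1) (hT : 0 < T)
    (hM : ∀ v, ‖v‖ ^ 2 ≤ M * (‖J v‖ ^ 2 + ‖G v‖ ^ 2))
    (hη : MemLp η 2 (volume.restrict (Ioc 0 T))) :
    ∃ w : ℝ → V, MemLp w 2 (volume.restrict (Ioc 0 T)) ∧ SolvesVolterra J G α T η w := by
  obtain ⟨u, hu, -⟩ := IsVolterraSolution.exists_and_energy hα hα1 hT hM
    ((adjoint G).compLpL 2 _ hη.toLp)
  exact ⟨u, Lp.memLp u, (solvesVolterra_iff hα hη.toLp u hη.coeFn_toLp .rfl).2 hu⟩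

theorem SolvesVolterra.unique (hα : 0 < α) (hα1 : α < 1) (hT : 0 < T)
    (hM : ∀ v, ‖v‖ ^ 2 ≤ M * (‖J v‖ ^ 2 + ‖G v‖ ^ 2))
    (hη : MemLp η 2 (volume.restrict (Ioc 0 T))) {w₁ w₂ : ℝ → V}
    (hw₁ : MemLp w₁ 2 (volume.restrict (Ioc 0 T))) (hw₂ : MemLp w₂ 2 (volume.restrict (Ioc 0 T)))
    (h₁ : SolvesVolterra J G α T η w₁) (h₂ : SolvesVolterra J G α T η w₂) :
    w₁ =ᵐ[volume.restrict (Ioc 0 T)] w₂ := by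
  have := IsVolterraSolution.unique hα hα1 hT hM
    ((solvesVolterra_iff hα hη.toLp hw₁.toLp hη.coeFn_toLp hw₁.coeFn_toLp).1 h₁)
    ((solvesVolterra_iff hα hη.toLp hw₂.toLp hη.coeFn_toLp hw₂.coeFn_toLp).1 h₂)
  exact (MemLp.toLp_eq_toLp_iff hw₁ hw₂).1 this

/-- The energy inequality. -/
theorem SolvesVolterra.energy (hα : 0 < α) (hα1 : α < 1)
    (hM : ∀ v, ‖v‖ ^ 2 ≤ M * (‖J v‖ ^ 2 + ‖G v‖ ^ 2))
    (hη : MemLp η 2 (volume.restrict (Ioc 0 T))) (hw : MemLp w 2 (volume.restrict (Ioc 0 T)))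
    (h : SolvesVolterra J G α T η w) {t : ℝ} (ht : t ∈ Ioc 0 T) :
    rlKernel (1 - α) t * ∫ s in (0 : ℝ)..t, ‖J (w s)‖ ^ 2
      ≤ ∫ s in (0 : ℝ)..t, inner ℝ (η s - G (w s)) (G (w s)) := by
  replace hη := MemLp.mono_Ioc hη ht.2
  replace hw := MemLp.mono_Ioc hw ht.2
  -- The inequality is known for a constructed solution only. The construction is repeated on `(0,
  -- t]`, whence the constant `k(t)`, and uniqueness there identifies it with `w`.
  obtain ⟨u, hu, he⟩ := IsVolterraSolution.exists_and_energy hα hα1 ht.1 hM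
    ((adjoint G).compLpL 2 _ hη.toLp)
  have hu' : u = hw.toLp := IsVolterraSolution.unique hα hα1 ht.1 hM hu
    ((solvesVolterra_iff hα hη.toLp hw.toLp hη.coeFn_toLp hw.coeFn_toLp).1 (h.mono ht.2))
  subst hu'
  rw [intervalIntegral.integral_of_le ht.1.le, intervalIntegral.integral_of_le ht.1.le]
  convert he using 1
  · rw [Lp.norm_sq_eq_integral]
    congr 1
    refine integral_congr_ae ?_
    filter_upwards [J.coeFn_compLpL hw.toLp, hw.coeFn_toLp] with s e1 e2
    rw [e1, e2]
  · rw [inner_sub_left, inner_adjoint_comp_compLpL, inner_compLpL_adjoint, ← inner_sub_left,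
      L2.inner_def]
    refine integral_congr_ae ?_
    filter_upwards [Lp.coeFn_sub hη.toLp (G.compLpL 2 _ hw.toLp : L2Time t K),
      G.coeFn_compLpL hw.toLp, hη.coeFn_toLp, hw.coeFn_toLp] with s e1 e2 e3 e4
    rw [e1, Pi.sub_apply, e2, e3, e4]

/-- The primitive of a solution solves the equation with the primitive of the source. -/
theorem SolvesVolterra.primitive (hα : 0 < α)
    (hη : MemLp η 2 (volume.restrict (Ioc 0 T))) (hw : MemLp w 2 (volume.restrict (Ioc 0 T)))
    (h : SolvesVolterra J G α T η w) :
    SolvesVolterra J G α T (fun t => ∫ s in (0 : ℝ)..t, η s)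
      (fun t => ∫ s in (0 : ℝ)..t, w s) := by
  have hz : MemLp (fun s => adjoint G (η s - G (w s))) 2 (volume.restrict (Ioc 0 T)) :=
    MemLp.clm_comp (adjoint G) (hη.sub (MemLp.clm_comp G hw))
  have hz1 := MemLp.integrableOn_Ioc hz
  have hg := integrableOn_rlKernel hα T
  have h1 := integrableOn_rlKernel one_pos T
  filter_upwards [volterra_volterra hg h1 hz1, volterra_volterra h1 hg hz1,
    ae_restrict_mem measurableSet_Ioc] with t e1 e2 ht
  have e3 : adjoint J (J (∫ s in (0 : ℝ)..t, w s))
      = volterra (rlKernel 1) (fun s => adjoint J (J (w s))) t := by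
    rw [volterra_rlKernel_one]
    exact (clm_primitive (adjoint J ∘L J) hw ht).symm
  -- Integrating the equation is convolution with `1`, which commutes with `I^α`.
  rw [e3, volterra_congr ht (fun _ _ => rfl) h, e2]
  have e4 : volterra (volterra (rlKernel 1) (rlKernel α)) (fun s => adjoint G (η s - G (w s))) t
      = volterra (volterra (rlKernel α) (rlKernel 1)) (fun s => adjoint G (η s - G (w s))) t :=
    volterra_congr ht (fun s _ => volterra_comm _ _ s) .rfl
  rw [e4, ← e1]
  refine volterra_congr ht (fun _ _ => rfl) ?_
  filter_upwards [ae_restrict_mem measurableSet_Ioc] with s hs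
  have hGw := MemLp.clm_comp G hw
  have hz2 : MemLp (fun s => η s - G (w s)) 2 (volume.restrict (Ioc 0 T)) := hη.sub hGw
  rw [volterra_rlKernel_one, clm_primitive (adjoint G) hz2 hs, intervalIntegral.integral_sub
    (MemLp.intervalIntegrable_Ioc hη hs) (MemLp.intervalIntegrable_Ioc hGw hs),
    clm_primitive G hw hs]

/-- Multiplication of a solution by time. -/
theorem SolvesVolterra.time_smul (hα : 0 < α)
    (hη : MemLp η 2 (volume.restrict (Ioc 0 T))) (hw : MemLp w 2 (volume.restrict (Ioc 0 T)))
    (h : SolvesVolterra J G α T η w) :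
    SolvesVolterra J G α T (fun t => t • η t + α • ∫ s in (0 : ℝ)..t, (η s - G (w s)))
      (fun t => t • w t) := by
  have hz : MemLp (fun s => η s - G (w s)) 2 (volume.restrict (Ioc 0 T)) :=
    hη.sub (MemLp.clm_comp G hw)
  filter_upwards [ae_smul_volterra_rlKernel hα (MemLp.clm_comp (adjoint G) hz), h,
    ae_restrict_mem measurableSet_Ioc] with t e1 e2 ht
  rw [map_smul, map_smul, e2, e1]
  refine volterra_congr ht (fun _ _ => rfl) ?_
  filter_upwards [ae_restrict_mem measurableSet_Ioc] with s hs
  simp only [Pi.add_apply, Pi.smul_apply]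
  rw [clm_primitive (adjoint G) hz hs]
  simp only [map_smul, map_sub, map_add, smul_sub]
  abel

end SolutionFunctions

/-! ### Energy bounds and the derivative of `t w(t)`. -/

section Regularity

open Filter Topology ContinuousLinearMap

variable {V H K : Type*} [NormedAddCommGroup V] [InnerProductSpace ℝ V] [CompleteSpace V]
  [NormedAddCommGroup H] [InnerProductSpace ℝ H] [CompleteSpace H]
  [NormedAddCommGroup K] [InnerProductSpace ℝ K] [CompleteSpace K]
  {T α M : ℝ} {J : V →L[ℝ] H} {G : V →L[ℝ] K} {η η' : ℝ → K} {w : ℝ → V}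

theorem MemLp.intervalIntegrable_norm_sq {E : Type*} [NormedAddCommGroup E] {f : ℝ → E} {t T : ℝ}
    (hf : MemLp f 2 (volume.restrict (Ioc 0 T))) (ht : t ∈ Ioc 0 T) :
    IntervalIntegrable (fun s => ‖f s‖ ^ 2) volume 0 t :=
  (intervalIntegrable_iff_integrableOn_Ioc_of_le ht.1.le).2
    ((MemLp.mono_Ioc hf ht.2).integrable_norm_pow (p := 2) (by norm_num))

theorem MemLp.intervalIntegrable_inner {K : Type*} [NormedAddCommGroup K] [InnerProductSpace ℝ K]
    {T : ℝ} {f g : ℝ → K} {t : ℝ}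
    (hf : MemLp f 2 (volume.restrict (Ioc 0 T))) (hg : MemLp g 2 (volume.restrict (Ioc 0 T)))
    (ht : t ∈ Ioc 0 T) : IntervalIntegrable (fun s => inner ℝ (f s) (g s)) volume 0 t := by
  rw [intervalIntegrable_iff_integrableOn_Ioc_of_le ht.1.le]
  have hf' := MemLp.mono_Ioc hf ht.2
  have hg' := MemLp.mono_Ioc hg ht.2
  refine (L2.integrable_inner (𝕜 := ℝ) hf'.toLp hg'.toLp).congr ?_
  filter_upwards [hf'.coeFn_toLp, hg'.coeFn_toLp] with s h1 h2
  rw [h1, h2]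

/-- Since `∫⟨η - G w, G w⟩ ≥ 0` by the energy inequality, expanding `‖(η - G w) + G w‖²` bounds both
summands by `η`. The third bound uses `⟨η - x, x⟩ ≤ ‖η‖² / 4`. -/
theorem SolvesVolterra.integral_bounds (hα : 0 < α) (hα1 : α < 1)
    (hM : ∀ v, ‖v‖ ^ 2 ≤ M * (‖J v‖ ^ 2 + ‖G v‖ ^ 2))
    (hη : MemLp η 2 (volume.restrict (Ioc 0 T))) (hw : MemLp w 2 (volume.restrict (Ioc 0 T)))
    (h : SolvesVolterra J G α T η w) {t : ℝ} (ht : t ∈ Ioc 0 T) :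
    ∫ s in (0 : ℝ)..t, ‖G (w s)‖ ^ 2 ≤ ∫ s in (0 : ℝ)..t, ‖η s‖ ^ 2 ∧
    ∫ s in (0 : ℝ)..t, ‖η s - G (w s)‖ ^ 2 ≤ ∫ s in (0 : ℝ)..t, ‖η s‖ ^ 2 ∧
    rlKernel (1 - α) t * ∫ s in (0 : ℝ)..t, ‖J (w s)‖ ^ 2
      ≤ 1 / 4 * ∫ s in (0 : ℝ)..t, ‖η s‖ ^ 2 := by
  have hGw := MemLp.clm_comp G hw
  have hz : MemLp (fun s => η s - G (w s)) 2 (volume.restrict (Ioc 0 T)) := hη.sub hGw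
  have i1 := MemLp.intervalIntegrable_norm_sq hη ht
  have i2 := MemLp.intervalIntegrable_norm_sq hz ht
  have i3 := MemLp.intervalIntegrable_norm_sq hGw ht
  have i4 := MemLp.intervalIntegrable_inner hz hGw ht
  have he := h.energy hα hα1 hM hη hw ht
  have h0 : ∀ {F : Type _} [NormedAddCommGroup F] (f : ℝ → F),
      0 ≤ ∫ s in (0 : ℝ)..t, ‖f s‖ ^ 2 := fun f =>
    intervalIntegral.integral_nonneg ht.1.le fun _ _ => sq_nonneg _
  have hk : 0 ≤ rlKernel (1 - α) t * ∫ s in (0 : ℝ)..t, ‖J (w s)‖ ^ 2 :=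
    mul_nonneg (rlKernel_nonneg (by linarith) ht.1.le)
      (intervalIntegral.integral_nonneg ht.1.le fun _ _ => sq_nonneg _)
  have hsum : ∫ s in (0 : ℝ)..t, ‖η s‖ ^ 2 = (∫ s in (0 : ℝ)..t, ‖η s - G (w s)‖ ^ 2)
      + 2 * (∫ s in (0 : ℝ)..t, inner ℝ (η s - G (w s)) (G (w s)))
      + ∫ s in (0 : ℝ)..t, ‖G (w s)‖ ^ 2 := by
    rw [← intervalIntegral.integral_const_mul, ← intervalIntegral.integral_add i2 (i4.const_mul 2),
      ← intervalIntegral.integral_add (i2.add (i4.const_mul 2)) i3]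
    refine intervalIntegral.integral_congr fun s _ => ?_
    have := norm_add_sq_real (η s - G (w s)) (G (w s))
    rwa [sub_add_cancel] at this
  have hquart : ∫ s in (0 : ℝ)..t, inner ℝ (η s - G (w s)) (G (w s))
      ≤ 1 / 4 * ∫ s in (0 : ℝ)..t, ‖η s‖ ^ 2 := by
    rw [← intervalIntegral.integral_const_mul]
    refine intervalIntegral.integral_mono_on ht.1.le i4 (i1.const_mul _) fun s _ => ?_
    -- `‖η - 2x‖² ≥ 0` with `x = G w`.
    have h1 := norm_sub_sq_real (η s) ((2 : ℝ) • G (w s))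
    rw [real_inner_smul_right, norm_smul, mul_pow] at h1
    rw [inner_sub_left, real_inner_self_eq_norm_sq]
    norm_num at h1
    nlinarith [sq_nonneg ‖η s - (2 : ℝ) • G (w s)‖]
  have h1 := h0 fun s => η s - G (w s)
  have h2 := h0 fun s => G (w s)
  exact ⟨by linarith, by linarith, he.trans hquart⟩

theorem norm_average_sq_le {V F : Type*} [NormedAddCommGroup V] [InnerProductSpace ℝ V]
    [CompleteSpace V] [NormedAddCommGroup F] [InnerProductSpace ℝ F] [CompleteSpace F]
    (L : V →L[ℝ] F) {f : ℝ → V} {t T : ℝ} (hf : MemLp f 2 (volume.restrict (Ioc 0 T)))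
    (ht : t ∈ Ioc 0 T) :
    ‖L (t⁻¹ • ∫ s in (0 : ℝ)..t, f s)‖ ^ 2 ≤ t⁻¹ * ∫ s in (0 : ℝ)..t, ‖L (f s)‖ ^ 2 := by
  have e := norm_integral_sq_le ht.1 (MemLp.mono_Ioc (MemLp.clm_comp L hf) ht.2)
  have ht0 := ht.1
  rw [map_smul, ← clm_primitive L hf ht, norm_smul, mul_pow, Real.norm_of_nonneg
    (inv_nonneg.2 ht0.le)]
  calc _ ≤ t⁻¹ ^ 2 * (t * ∫ s in (0 : ℝ)..t, ‖L (f s)‖ ^ 2) := by gcongr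
    _ = _ := by field_simp

/-- The derivative of `t w` is found as the solution `f` with source `σ = η' + α (η - G w)`, where
`η'` is the derivative of `t η`: both `t w` and `∫₀ᵗ f` solve the equation with source `∫₀ᵗ σ`,
hence coincide. -/
theorem SolvesVolterra.regularity (hα : 0 < α) (hα1 : α < 1) (hT : 0 < T)
    (hM : ∀ v, ‖v‖ ^ 2 ≤ M * (‖J v‖ ^ 2 + ‖G v‖ ^ 2))
    (hη : MemLp η 2 (volume.restrict (Ioc 0 T))) (hη' : MemLp η' 2 (volume.restrict (Ioc 0 T)))
    (hη₁ : ∀ᵐ t ∂volume.restrict (Ioc 0 T), t • η t = ∫ s in (0 : ℝ)..t, η' s)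
    (hw : MemLp w 2 (volume.restrict (Ioc 0 T))) (h : SolvesVolterra J G α T η w) :
    ∃ f : ℝ → V, MemLp f 2 (volume.restrict (Ioc 0 T)) ∧
      ((fun t => t⁻¹ • ∫ s in (0 : ℝ)..t, f s) =ᵐ[volume.restrict (Ioc 0 T)] w) ∧
      ∀ t ∈ Ioc 0 T,
        ∫ s in (0 : ℝ)..t, ‖G (f s)‖ ^ 2 ≤ 2 * ∫ s in (0 : ℝ)..t, (‖η s‖ ^ 2 + ‖η' s‖ ^ 2) ∧
        ‖G (t⁻¹ • ∫ s in (0 : ℝ)..t, f s)‖ ^ 2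
          ≤ 2 * t⁻¹ * ∫ s in (0 : ℝ)..t, (‖η s‖ ^ 2 + ‖η' s‖ ^ 2) ∧
        ‖J (t⁻¹ • ∫ s in (0 : ℝ)..t, f s)‖ ^ 2
          ≤ Real.Gamma (1 - α) / 2 * t ^ (α - 1) *
            ∫ s in (0 : ℝ)..t, (‖η s‖ ^ 2 + ‖η' s‖ ^ 2) := by
  set z : ℝ → K := fun s => η s - G (w s) with hzdef
  have hz : MemLp z 2 (volume.restrict (Ioc 0 T)) := hη.sub (MemLp.clm_comp G hw)
  have hσ : MemLp (fun s => η' s + α • z s) 2 (volume.restrict (Ioc 0 T)) :=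
    hη'.add (hz.const_smul α)
  obtain ⟨f, hf, hsol⟩ := SolvesVolterra.exists (J := J) hα hα1 hT hM hσ
  have h1 := hsol.primitive hα hσ hf
  have h2 := h.time_smul hα hη hw
  have h3 : SolvesVolterra J G α T (fun t => ∫ s in (0 : ℝ)..t, (η' s + α • z s))
      (fun t => t • w t) := by
    filter_upwards [h2, ae_restrict_mem measurableSet_Ioc] with t ht ht'
    rw [ht]
    refine volterra_congr ht' (fun _ _ => rfl) ?_
    filter_upwards [hη₁, ae_restrict_mem measurableSet_Ioc] with s hs hs'
    have iz : IntervalIntegrable (fun s => α • z s) volume 0 s :=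
      (MemLp.intervalIntegrable_Ioc hz hs').smul α
    rw [hs, intervalIntegral.integral_add (MemLp.intervalIntegrable_Ioc hη' hs') iz,
      intervalIntegral.integral_smul]
  have h4 := SolvesVolterra.unique hα hα1 hT hM (memLp_primitive hσ) (memLp_primitive hf)
    (memLp_time_smul hw) h1 h3
  refine ⟨f, hf, ?_, fun t ht => ?_⟩
  · filter_upwards [h4, ae_restrict_mem measurableSet_Ioc] with t e ht
    rw [e, inv_smul_smul₀ ht.1.ne']
  set D := ∫ s in (0 : ℝ)..t, (‖η s‖ ^ 2 + ‖η' s‖ ^ 2) with hD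
  have i1 := MemLp.intervalIntegrable_norm_sq hη ht
  have i2 := MemLp.intervalIntegrable_norm_sq hη' ht
  have i3 := MemLp.intervalIntegrable_norm_sq hz ht
  have i4 := MemLp.intervalIntegrable_norm_sq hσ ht
  -- The factor `2` is from `(a + b)² ≤ 2 (a² + b²)`; `α ≤ 1` and `∫‖z‖² ≤ ∫‖η‖²` add nothing to it.
  have hσD : ∫ s in (0 : ℝ)..t, ‖η' s + α • z s‖ ^ 2 ≤ 2 * D := by
    have hzη := (h.integral_bounds hα hα1 hM hη hw ht).2.1
    calc _ ≤ ∫ s in (0 : ℝ)..t, 2 * (‖z s‖ ^ 2 + ‖η' s‖ ^ 2) := by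
          refine intervalIntegral.integral_mono_on ht.1.le i4 ((i3.add i2).const_mul 2) fun s _ => ?_
          have e1 : ‖η' s + α • z s‖ ≤ ‖η' s‖ + ‖z s‖ := by
            refine (norm_add_le _ _).trans ?_
            rw [norm_smul, Real.norm_of_nonneg hα.le]
            gcongr
            exact mul_le_of_le_one_left (norm_nonneg _) hα1.le
          calc _ ≤ (‖η' s‖ + ‖z s‖) ^ 2 := by gcongr
            _ ≤ _ := by nlinarith [sq_nonneg (‖η' s‖ - ‖z s‖)]
      _ ≤ 2 * D := by
          rw [intervalIntegral.integral_const_mul, intervalIntegral.integral_add i3 i2, hD,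
            intervalIntegral.integral_add i1 i2]
          linarith
  obtain ⟨b1, -, b3⟩ := hsol.integral_bounds hα hα1 hM hσ hf ht
  have ht0 := ht.1
  have hG : ∫ s in (0 : ℝ)..t, ‖G (f s)‖ ^ 2 ≤ 2 * D := b1.trans hσD
  refine ⟨hG, ?_, ?_⟩
  · calc _ ≤ t⁻¹ * ∫ s in (0 : ℝ)..t, ‖G (f s)‖ ^ 2 := norm_average_sq_le G hf ht
      _ ≤ t⁻¹ * (2 * D) := by gcongr
      _ = _ := by ring
  · refine (norm_average_sq_le J hf ht).trans ?_
    have hΓ := Real.Gamma_pos_of_pos (show 0 < 1 - α by linarith)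
    have hk : rlKernel (1 - α) t = (Real.Gamma (1 - α) * t ^ α)⁻¹ := by
      rw [rlKernel, sub_right_comm, sub_self, zero_sub, Real.rpow_neg ht0.le, mul_inv, div_eq_mul_inv,
        mul_comm]
    rw [hk, inv_mul_le_iff₀ (by positivity)] at b3
    -- The factors are the average over `(0, t)`, the reciprocal of `k(t)`, and `1/4` of the bound
    -- `2 D` for the source.
    calc _ ≤ t⁻¹ * (Real.Gamma (1 - α) * t ^ α * (1 / 4 * (2 * D))) := by
          refine mul_le_mul_of_nonneg_left (b3.trans ?_) (inv_nonneg.2 ht0.le)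
          gcongr
      _ = _ := by
          rw [Real.rpow_sub_one ht0.ne']
          field_simp
          ring

end Regularity

/-! ### From the Caputo derivative to the Volterra equation. -/

section Caputo

open Filter Topology ContinuousLinearMap

/-- Applying `I^α` to `I^(1-α) φ = ∫₀ᵗ g` gives `∫₀ᵗ φ = ∫₀ᵗ I^α g`, and functions with equal
primitives agree almost everywhere. -/
theorem HasCaputoDeriv₀.eq_volterra {α T : ℝ} (hα : 0 < α) (hα1 : α < 1) {φ g : ℝ → ℝ}
    (h : HasCaputoDeriv₀ α T φ g) : φ =ᵐ[volume.restrict (Ioc 0 T)] volterra (rlKernel α) g := by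
  have hβ : 0 < 1 - α := by linarith
  have ig := integrableOn_rlKernel hα T
  have ik := integrableOn_rlKernel hβ T
  have i1 := integrableOn_rlKernel one_pos T
  have hφ : IntegrableOn φ (Ioc 0 T) volume := h.integrable
  have hg : IntegrableOn g (Ioc 0 T) volume := h.integrable_deriv
  have hvg := integrableOn_volterra ig hg
  suffices hd : (fun t => φ t - volterra (rlKernel α) g t) =ᵐ[volume.restrict (Ioc 0 T)] 0 by
    filter_upwards [hd] with t ht using sub_eq_zero.1 ht
  refine ae_eq_zero_of_primitive (hφ.sub hvg) ?_
  filter_upwards [volterra_volterra ig ik hφ, volterra_volterra ig i1 hg,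
    volterra_volterra i1 ig hg, ae_restrict_mem measurableSet_Ioc] with t e1 e2 e3 ht
  have hii : ∀ f : ℝ → ℝ, IntegrableOn f (Ioc 0 T) volume → IntervalIntegrable f volume 0 t :=
    fun f hf => (intervalIntegrable_iff_integrableOn_Ioc_of_le ht.1.le).2
      (hf.mono_set (Ioc_subset_Ioc_right ht.2))
  rw [intervalIntegral.integral_sub (hii _ hφ) (hii _ hvg), sub_eq_zero,
    ← volterra_rlKernel_one, ← volterra_rlKernel_one, e3]
  have a1 : volterra (rlKernel α) (volterra (rlKernel (1 - α)) φ) t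
      = volterra (rlKernel α) (volterra (rlKernel 1) g) t := by
    refine volterra_congr ht (fun _ _ => rfl) ?_
    filter_upwards [h.rlIntegral_eq] with s hs
    rw [volterra_rlKernel_one, ← hs, rlIntegral_eq_volterra]
  rw [volterra_congr ht (fun s _ => volterra_comm (rlKernel 1) (rlKernel α) s) .rfl, ← e2, ← a1, e1]
  refine volterra_congr ht (fun s hs => ?_) .rfl
  rw [volterra_rlKernel hα hβ hs.1, add_sub_cancel]

/-- Each test vector `v` gives the identity off a null set that depends on `v`. The essential range
of a strongly measurable function is separable, so a single null set suffices, and no separability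
of `V` is assumed. -/
theorem solvesVolterra_of_hasCaputoDeriv {V H K : Type*} [NormedAddCommGroup V]
    [InnerProductSpace ℝ V] [CompleteSpace V] [NormedAddCommGroup H] [InnerProductSpace ℝ H]
    [CompleteSpace H] [NormedAddCommGroup K] [InnerProductSpace ℝ K] [CompleteSpace K]
    {T α : ℝ} (hα : 0 < α) (hα1 : α < 1) {J : V →L[ℝ] H} {G : V →L[ℝ] K} {η : ℝ → K} {w : ℝ → V}
    (hη : MemLp η 2 (volume.restrict (Ioc 0 T))) (hw : MemLp w 2 (volume.restrict (Ioc 0 T)))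
    (h : ∀ v, HasCaputoDeriv₀ α T (fun t => inner ℝ (J (w t)) (J v))
      (fun t => inner ℝ (η t - G (w t)) (G v))) : SolvesVolterra J G α T η w := by
  set z : ℝ → V := fun s => adjoint G (η s - G (w s)) with hzdef
  have hz : MemLp z 2 (volume.restrict (Ioc 0 T)) :=
    MemLp.clm_comp (adjoint G) (hη.sub (MemLp.clm_comp G hw))
  have hm : AEStronglyMeasurable (fun t => adjoint J (J (w t)) - volterra (rlKernel α) z t)
      (volume.restrict (Ioc 0 T)) :=
    (MemLp.clm_comp (adjoint J ∘L J) hw).1.sub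
      (memLp_two_volterra (integrableOn_rlKernel hα T) hz).1
  obtain ⟨t, htsep, ht⟩ := hm.isSeparable_ae_range
  have key := ae_eq_zero_of_forall_dual_of_isSeparable ℝ htsep (fun c => ?_) ht
  · filter_upwards [key] with t ht using sub_eq_zero.1 ht
  obtain ⟨v, rfl⟩ := (InnerProductSpace.toDual ℝ V).surjective c
  filter_upwards [(h v).eq_volterra hα hα1,
    (innerSL ℝ v).ae_volterra_comp (integrableOn_rlKernel hα T) (MemLp.integrableOn_Ioc hz)]
    with s e1 e2
  rw [InnerProductSpace.toDual_apply_apply, inner_sub_right, adjoint_inner_right, real_inner_comm, e1,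
    ← innerSL_apply_apply ℝ, ← e2, Pi.zero_apply, sub_eq_zero]
  congr 1
  ext r
  rw [innerSL_apply_apply, adjoint_inner_right, real_inner_comm]

end Caputo

/-! ### The concrete operators on `L²(Ω)` and `H¹₀(Ω)`. -/

section Sobolev

open ContinuousLinearMap

/-- Multiplication by a bounded measurable function, as an operator on `L²`. -/
noncomputable def mulL2 {X : Type*} [MeasurableSpace X] {μ : Measure X} (F : Type*)
    [NormedAddCommGroup F] [NormedSpace ℝ F] {m : X → ℝ} (hm : MemLp m ⊤ μ) :
    Lp F 2 μ →L[ℝ] Lp F 2 μ :=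
  (lsmul ℝ ℝ : ℝ →L[ℝ] F →L[ℝ] F).holderL μ ⊤ 2 2 hm.toLp

theorem coeFn_mulL2 {X F : Type*} [MeasurableSpace X] {μ : Measure X}
    [NormedAddCommGroup F] [NormedSpace ℝ F] {m : X → ℝ} (hm : MemLp m ⊤ μ) (q : Lp F 2 μ) :
    mulL2 F hm q =ᵐ[μ] fun x => m x • q x := by
  filter_upwards [(lsmul ℝ ℝ : ℝ →L[ℝ] F →L[ℝ] F).coeFn_holder (r := 2) hm.toLp q, hm.coeFn_toLp]
    with x h1 h2
  rw [mulL2, holderL_apply_apply, h1, h2, lsmul_apply]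

variable {d : ℕ} {Ω : Set (EuclideanSpace ℝ (Fin d))} {κ : EuclideanSpace ℝ (Fin d) → ℝ}
  {κmin κmax : ℝ}

theorem memLp_top_sqrt (hκ : AEMeasurable κ (volume.restrict Ω))
    (h : ∀ᵐ x ∂volume.restrict Ω, κmin ≤ κ x ∧ κ x ≤ κmax) :
    MemLp (fun x => √(κ x)) ⊤ (volume.restrict Ω) := by
  refine memLp_top_of_bound hκ.sqrt.aestronglyMeasurable √κmax ?_
  filter_upwards [h] with x hx
  rw [Real.norm_of_nonneg (Real.sqrt_nonneg _)]
  exact Real.sqrt_le_sqrt hx.2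

theorem memLp_top_inv_sqrt (hκ : AEMeasurable κ (volume.restrict Ω)) (h0 : 0 < κmin)
    (h : ∀ᵐ x ∂volume.restrict Ω, κmin ≤ κ x ∧ κ x ≤ κmax) :
    MemLp (fun x => (√(κ x))⁻¹) ⊤ (volume.restrict Ω) := by
  refine memLp_top_of_bound hκ.sqrt.inv.aestronglyMeasurable (√κmin)⁻¹ ?_
  filter_upwards [h] with x hx
  rw [Real.norm_of_nonneg (inv_nonneg.2 (Real.sqrt_nonneg _))]
  exact inv_anti₀ (Real.sqrt_pos.2 h0) (Real.sqrt_le_sqrt hx.1)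

theorem weightedNormSq_eq {m : EuclideanSpace ℝ (Fin d) → ℝ} (hm : MemLp m ⊤ (volume.restrict Ω))
    (q : L2 Ω (EuclideanSpace ℝ (Fin d))) :
    weightedNormSq Ω m q = ‖mulL2 (EuclideanSpace ℝ (Fin d)) hm q‖ ^ 2 := by
  rw [Lp.norm_sq_eq_integral, weightedNormSq]
  refine integral_congr_ae ?_
  filter_upwards [coeFn_mulL2 hm q] with x hx
  rw [hx]

/-- The embedding of `H¹₀(Ω)` into `L²(Ω)`. -/
noncomputable def h10ValL (Ω : Set (EuclideanSpace ℝ (Fin d))) : H10 Ω →L[ℝ] L2 Ω ℝ :=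
  WithLp.fstL 2 ℝ _ _ ∘L (H10 Ω).subtypeL

/-- The weak gradient as an operator on `H¹₀(Ω)`. -/
noncomputable def h10GradL (Ω : Set (EuclideanSpace ℝ (Fin d))) :
    H10 Ω →L[ℝ] L2 Ω (EuclideanSpace ℝ (Fin d)) :=
  WithLp.sndL 2 ℝ _ _ ∘L (H10 Ω).subtypeL

theorem h10ValL_apply (v : H10 Ω) : h10ValL Ω v = h10Val v := rfl

theorem h10GradL_apply (v : H10 Ω) : h10GradL Ω v = h10Grad v := rfl

theorem norm_sq_h10 (v : H10 Ω) : ‖v‖ ^ 2 = ‖h10Val v‖ ^ 2 + ‖h10Grad v‖ ^ 2 :=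
  WithLp.prod_norm_sq_eq_of_L2 (v : L2Pair Ω)

theorem mulL2_inv_mulL2 {X F : Type*} [MeasurableSpace X] {μ : Measure X}
    [NormedAddCommGroup F] [NormedSpace ℝ F] {m : X → ℝ} (hm : MemLp m ⊤ μ)
    (hm' : MemLp (fun x => (m x)⁻¹) ⊤ μ) (h0 : ∀ᵐ x ∂μ, m x ≠ 0) (q : Lp F 2 μ) :
    mulL2 F hm' (mulL2 F hm q) = q := by
  refine Lp.ext ?_
  filter_upwards [coeFn_mulL2 hm' (mulL2 F hm q), coeFn_mulL2 hm q, h0] with x h1 h2 h3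
  rw [h1, h2, inv_smul_smul₀ h3]

/-- With `q = θ`, `r = ∇w`, `s = ∇v` this rewrites the right-hand side of the weak form as `⟨η - G
w, G v⟩`. -/
theorem inner_mulL2_inv_sub {F : Type*} {X : Type*} [MeasurableSpace X] {μ : Measure X}
    [NormedAddCommGroup F] [InnerProductSpace ℝ F] {k : X → ℝ} (hm : MemLp (fun x => √(k x)) ⊤ μ)
    (hm' : MemLp (fun x => (√(k x))⁻¹) ⊤ μ) (h0 : ∀ᵐ x ∂μ, 0 < k x) (q r s : Lp F 2 μ) :
    inner ℝ (mulL2 F hm' q - mulL2 F hm r) (mulL2 F hm s)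
      = inner ℝ q s - ∫ x, k x * inner ℝ (r x) (s x) ∂μ := by
  rw [inner_sub_left, L2.inner_def, L2.inner_def, L2.inner_def]
  congr 1
  · refine integral_congr_ae ?_
    filter_upwards [coeFn_mulL2 hm' q, coeFn_mulL2 hm s, h0] with x h1 h2 h3
    rw [h1, h2, real_inner_smul_left, real_inner_smul_right,
      inv_mul_cancel_left₀ (Real.sqrt_pos.2 h3).ne']
  · refine integral_congr_ae ?_
    filter_upwards [coeFn_mulL2 hm r, coeFn_mulL2 hm s, h0] with x h1 h2 h3
    rw [h1, h2, real_inner_smul_left, real_inner_smul_right, ← mul_assoc,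
      Real.mul_self_sqrt h3.le]

theorem HasL2TimeDeriv.clm_comp {E F : Type*} [NormedAddCommGroup E] [NormedSpace ℝ E]
    [CompleteSpace E] [NormedAddCommGroup F] [NormedSpace ℝ F] [CompleteSpace F] {T : ℝ}
    {f f' : ℝ → E} (L : E →L[ℝ] F) (h : HasL2TimeDeriv T f f') :
    HasL2TimeDeriv T (fun t => L (f t)) (fun t => L (f' t)) := by
  obtain ⟨c, hc⟩ := h.exists_const
  refine ⟨MemLp.clm_comp L h.memLp, L c, ?_⟩
  filter_upwards [hc, ae_restrict_mem measurableSet_Ioc] with t e ht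
  rw [e, map_add, clm_primitive L h.memLp ht]

theorem ae_hasDerivAt_smul_average {E : Type*} [NormedAddCommGroup E] [NormedSpace ℝ E]
    [CompleteSpace E] {T : ℝ} (hT : 0 < T) {f : ℝ → E}
    (hf : MemLp f 2 (volume.restrict (Ioc 0 T))) :
    ∀ᵐ t ∂volume.restrict (Ioc 0 T),
      HasDerivAt (fun s => s • s⁻¹ • ∫ r in (0 : ℝ)..s, f r) (f t) t := by
  have hd := (MemLp.intervalIntegrable_Ioc hf ⟨hT, le_rfl⟩).ae_hasDerivAt_integral
  filter_upwards [ae_restrict_of_ae hd, ae_restrict_mem measurableSet_Ioc] with t h ht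
  refine (h (by rw [uIcc_of_le hT.le]; exact Ioc_subset_Icc_self ht) 0 left_mem_uIcc
    ).congr_of_eventuallyEq ?_
  filter_upwards [Ioi_mem_nhds ht.1] with s hs
  rw [smul_inv_smul₀ (ne_of_gt hs)]

end Sobolev

theorem lemma2p3 (α : ℝ) (hα0 : 0 < α) (hα1 : α < 1) :
    ∃ C : ℝ, 0 < C ∧
      ∀ (d : ℕ) (Ω : Set (EuclideanSpace ℝ (Fin d))), IsOpen Ω → Bornology.IsBounded Ω →
      ∀ (κ : EuclideanSpace ℝ (Fin d) → ℝ) (κmin κmax : ℝ),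
        AEMeasurable κ (volume.restrict Ω) → 0 < κmin →
        (∀ᵐ x ∂volume.restrict Ω, κmin ≤ κ x ∧ κ x ≤ κmax) →
      ∀ (T : ℝ), 0 < T →
      ∀ (θ : ℝ → L2 Ω (EuclideanSpace ℝ (Fin d))), MemLp θ 2 (volume.restrict (Ioc 0 T)) →
      ∀ (w : ℝ → H10 Ω), IsWeakSolution α T Ω κ θ w →
        -- the bound of `∇w`
        (∀ t ∈ Ioc 0 T,
          ∫ s in (0 : ℝ)..t, weightedNormSq Ω (fun x => √(κ x)) (h10Grad (w s))
            ≤ ∫ s in (0 : ℝ)..t, weightedNormSq Ω (fun x => (√(κ x))⁻¹) (θ s)) ∧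
        -- the bounds that involve `Θ'`, where `Θ t = t θ(t)`
        (∀ Θ' : ℝ → L2 Ω (EuclideanSpace ℝ (Fin d)), HasL2TimeDeriv T (fun t => t • θ t) Θ' →
          -- `u` is the continuous representative of `w`, and `W'` the time derivative of `t w(t)`
          ∃ u W' : ℝ → H10 Ω,
            u =ᵐ[volume.restrict (Ioc 0 T)] w ∧
            ContinuousOn u (Ioc 0 T) ∧
            MemLp W' 2 (volume.restrict (Ioc 0 T)) ∧
            (∀ t ∈ Ioc 0 T, t • u t = ∫ s in (0 : ℝ)..t, W' s) ∧
            (∀ᵐ t ∂volume.restrict (Ioc 0 T), HasDerivAt (fun s => s • u s) (W' t) t) ∧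
            ∀ t ∈ Ioc 0 T,
              ∫ s in (0 : ℝ)..t, weightedNormSq Ω (fun x => √(κ x)) (h10Grad (W' s))
                ≤ 2 * ∫ s in (0 : ℝ)..t, (weightedNormSq Ω (fun x => (√(κ x))⁻¹) (θ s)
                    + weightedNormSq Ω (fun x => (√(κ x))⁻¹) (Θ' s)) ∧
              weightedNormSq Ω (fun x => √(κ x)) (h10Grad (u t))
                ≤ 2 * t⁻¹ * ∫ s in (0 : ℝ)..t, (weightedNormSq Ω (fun x => (√(κ x))⁻¹) (θ s)
                    + weightedNormSq Ω (fun x => (√(κ x))⁻¹) (Θ' s)) ∧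
              ‖h10Val (u t)‖ ^ 2
                ≤ C * t ^ (α - 1) *
                  ∫ s in (0 : ℝ)..t, (weightedNormSq Ω (fun x => (√(κ x))⁻¹) (θ s)
                    + weightedNormSq Ω (fun x => (√(κ x))⁻¹) (Θ' s))) := by
  refine ⟨Real.Gamma (1 - α) / 2, half_pos (Real.Gamma_pos_of_pos (by linarith)), ?_⟩
  intro d Ω _ _ κ κmin κmax hκ hmin hbd T hT θ hθ w hw
  have hpos : ∀ᵐ x ∂volume.restrict Ω, 0 < κ x := hbd.mono fun x hx => hmin.trans_le hx.1
  set A := mulL2 (EuclideanSpace ℝ (Fin d)) (memLp_top_sqrt hκ hbd) with hA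
  set B := mulL2 (EuclideanSpace ℝ (Fin d)) (memLp_top_inv_sqrt hκ hmin hbd) with hB
  set G : H10 Ω →L[ℝ] L2 Ω (EuclideanSpace ℝ (Fin d)) := A ∘L h10GradL Ω with hG
  have hBA : ∀ q, B (A q) = q := mulL2_inv_mulL2 _ _
    (hpos.mono fun x hx => (Real.sqrt_pos.2 hx).ne')
  -- Only `‖∇v‖ ≤ ‖B‖ ‖G v‖` is needed; the `L²` part of the norm is `J v` itself, so Poincaré's
  -- inequality does not enter.
  have hM : ∀ v : H10 Ω, ‖v‖ ^ 2 ≤ (1 + ‖B‖ ^ 2) * (‖h10ValL Ω v‖ ^ 2 + ‖G v‖ ^ 2) := by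
    intro v
    have h1 : ‖h10Grad v‖ ^ 2 ≤ ‖B‖ ^ 2 * ‖G v‖ ^ 2 := by
      rw [← mul_pow]
      have := B.le_opNorm (G v)
      rw [hG, ContinuousLinearMap.comp_apply, hBA, h10GradL_apply] at this
      exact pow_le_pow_left₀ (norm_nonneg _) this 2
    rw [norm_sq_h10, h10ValL_apply]
    nlinarith [sq_nonneg ‖h10Val v‖, sq_nonneg ‖G v‖,
      mul_nonneg (sq_nonneg ‖B‖) (sq_nonneg ‖h10Val v‖)]
  have hη : MemLp (fun t => B (θ t)) 2 (volume.restrict (Ioc 0 T)) := MemLp.clm_comp B hθ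
  have hsol : SolvesVolterra (h10ValL Ω) G α T (fun t => B (θ t)) w := by
    refine solvesVolterra_of_hasCaputoDeriv hα0 hα1 hη hw.memLp fun v => ?_
    have e : (fun t => inner ℝ (B (θ t) - G (w t)) (G v)) = _ := funext fun t =>
      inner_mulL2_inv_sub (memLp_top_sqrt hκ hbd) (memLp_top_inv_sqrt hκ hmin hbd) hpos (θ t)
        (h10Grad (w t)) (h10Grad v)
    rw [e]
    exact hw.hasCaputoDeriv v
  have eG : ∀ v : H10 Ω, weightedNormSq Ω (fun x => √(κ x)) (h10Grad v) = ‖G v‖ ^ 2 :=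
    fun v => weightedNormSq_eq _ _
  have eB : ∀ q, weightedNormSq Ω (fun x => (√(κ x))⁻¹) q = ‖B q‖ ^ 2 :=
    fun q => weightedNormSq_eq _ _
  simp only [eG, eB]
  refine ⟨fun t ht => (hsol.integral_bounds hα0 hα1 hM hη hw.memLp ht).1, fun Θ' hΘ => ?_⟩
  have hη₁ : HasL2TimeDeriv T (fun t => t • B (θ t)) (fun t => B (Θ' t)) := by
    simpa only [map_smul] using hΘ.clm_comp B
  obtain ⟨f, hf, hfw, hbounds⟩ := hsol.regularity hα0 hα1 hT hM hη hη₁.memLp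
    (hη₁.eq_primitive hT hη) hw.memLp
  -- The continuous representative is the running mean of `f`, with `f` as derivative of `t u(t)`.
  refine ⟨fun t => t⁻¹ • ∫ s in (0 : ℝ)..t, f s, f, hfw, ?_, hf, fun t ht => ?_,
    ae_hasDerivAt_smul_average hT hf, hbounds⟩
  · exact (continuousOn_inv₀.mono fun t ht => ne_of_gt ht.1).smul
      ((continuousOn_primitive_Icc hf).mono Ioc_subset_Icc_self)
  · rw [smul_inv_smul₀ ht.1.ne']
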